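/- A prefix-free machine is a partial computable function $M$ from finite binary strings to finite binary strings whose domain contains no string together with a proper prefix of it. Call a prefix-free machine $U$ universal if for every prefix-free machine $M$ there is a constant $c$ such that, whenever $M(p)=\sigma$, there is $q$ with $U(q)=\sigma$ and $|q|\le |p|+c$. Let $K(\sigma)=\min\{|p| : U(p)=\sigma\}$ be the prefix-free Kolmogorov complexity with respect to a universal prefix-free machine $U$, and let $\Omega=\sum_{V(p)\downarrow}2^{-|p|}$ be the halting probability of a universal prefix-free machine $V$ (for example $V=U$), identified with the infinite sequence of bits of its binary expansion. **Theorem.** Let $X$ be a left-c.e. real in $[0,1]$, given by a binary expansion $X(1)X(2)X(3)\dots$; that is, the number $\sum_{k\ge1} X(k)2^{-k}$ is the limit of a computable nondecreasing sequence of dyadic rationals. Write $X\restriction_n$ for the string of the first $n$ bits of $X$. Then $X$ can be computed from $\Omega$ with oracle-use $g(n)=\min_{i\ge n}K(X\restriction_i)$: there is an oracle program which, for every $n\ge 0$, with oracle $\Omega$ and input $n$, halts with output $X\restriction_n$, and for which the largest position of $\Omega$ queried during this computation is $g(n)$ (positions being counted from $1$). In particular, $X\restriction_n$ is computed from the first $g(n)$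 bits of $\Omega$. -/

import Mathlib

/-- A machine is a partial computable map from finite binary strings (programs) to finite binary
strings; it is prefix-free if no program in its domain is a proper prefix of another one. -/
structure IsPrefixFreeMachine (M : List Bool →. List Bool) : Prop where
  partrec : Partrec M
  prefixFree : ∀ p q : List Bool, (M p).Dom → (M q).Dom → p <+: q → p = q

/-- Universality, in the weakest usual sense: `U` simulates each prefix-free machine `M` with
programs that are longer by at most a constant `c` depending only on `M`. (If `U` simulates `M` by
prepending a fixed string to the programs of `M`, then this holds.) -/
structure IsUniversalPrefixFree (U : List Bool →. List Bool) : Prop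
    extends IsPrefixFreeMachine U where
  simulates : ∀ M : List Bool →. List Bool, IsPrefixFreeMachine M →
    ∃ c : ℕ, ∀ p σ : List Bool, σ ∈ M p → ∃ q : List Bool, σ ∈ U q ∧ q.length ≤ p.length + c

/-- The complexity of the string `σ` with respect to the machine `U`: the length of a shortest
program for `σ`, and `⊤` if there is none. For `U` universal prefix-free, this is the prefix-free
Kolmogorov complexity `K(σ)`. -/
noncomputable def complexity (U : List Bool →. List Bool) (σ : List Bool) : ℕ∞ :=
  ⨅ (p : List Bool) (_ : σ ∈ U p), (p.length : ℕ∞)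

/-- The halting probability of the machine `U`. -/
noncomputable def haltingProbability (U : List Bool →. List Bool) : ℝ :=
  ∑' p : {p : List Bool // (U p).Dom}, (2⁻¹ : ℝ) ^ (p : List Bool).length

/-- The binary expansion (after the binary point) of a real number, as a stream of bits. -/
noncomputable def binaryExpansion (x : ℝ) : ℕ → Bool :=
  fun n => finTwoEquiv (Real.digits x 2 n)

/-- The real number in `[0, 1]` with binary expansion `0.X(0)X(1)X(2)…`. -/
noncomputable def streamValue (X : ℕ → Bool) : ℝ :=
  Real.ofDigits (fun n => finTwoEquiv.symm (X n))

/-- The string formed by the first `n` bits of the stream `X`. -/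
def initialSegment (X : ℕ → Bool) (n : ℕ) : List Bool :=
  (List.range n).map X

/-- A real number is left-c.e. if it is the limit of a computable nondecreasing sequence of dyadic
rationals. -/
def IsLeftCE (x : ℝ) : Prop :=
  ∃ (a : ℕ → ℤ) (e : ℕ → ℕ), Computable a ∧ Computable e ∧
    Monotone (fun s => (a s : ℝ) / 2 ^ e s) ∧
    Filter.Tendsto (fun s => (a s : ℝ) / 2 ^ e s) Filter.atTop (nhds x)

/-- Programs with an oracle: the programs of `Nat.Partrec.Code`, with one more instruction
`query`, which asks the oracle for one bit. -/
inductive OracleCode : Type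
  | zero : OracleCode
  | succ : OracleCode
  | left : OracleCode
  | right : OracleCode
  | query : OracleCode
  | pair : OracleCode → OracleCode → OracleCode
  | comp : OracleCode → OracleCode → OracleCode
  | prec : OracleCode → OracleCode → OracleCode
  | rfind' : OracleCode → OracleCode

/-- `OracleCode.Halts Y c x r u`: the program `c`, run on input `x` with oracle `Y`, halts with
output `r`, and `u` is its oracle-use, that is, the largest position of the oracle queried
during the run, where the bits `Y 0, Y 1, Y 2, …` are at the positions `1, 2, 3, …`; and `u = 0` if
there was no query. The instructions are interpreted as in `Nat.Partrec.Code.eval`. -/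
inductive OracleCode.Halts (Y : ℕ → Bool) : OracleCode → ℕ → ℕ → ℕ → Prop
  | zero (x : ℕ) : Halts Y .zero x 0 0
  | succ (x : ℕ) : Halts Y .succ x (x + 1) 0
  | left (x : ℕ) : Halts Y .left x x.unpair.1 0
  | right (x : ℕ) : Halts Y .right x x.unpair.2 0
  | query (x : ℕ) : Halts Y .query x (Y x).toNat (x + 1)
  | pair {f g : OracleCode} {x r s u v : ℕ} :
      Halts Y f x r u → Halts Y g x s v → Halts Y (.pair f g) x (Nat.pair r s) (max u v)
  | comp {f g : OracleCode} {x y r u v : ℕ} :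
      Halts Y g x y u → Halts Y f y r v → Halts Y (.comp f g) x r (max u v)
  | prec_zero {f g : OracleCode} {a r u : ℕ} :
      Halts Y f a r u → Halts Y (.prec f g) (Nat.pair a 0) r u
  | prec_succ {f g : OracleCode} {a k y r u v : ℕ} :
      Halts Y (.prec f g) (Nat.pair a k) y u → Halts Y g (Nat.pair a (Nat.pair k y)) r v →
      Halts Y (.prec f g) (Nat.pair a (k + 1)) r (max u v)
  | rfind_found {f : OracleCode} {a m u : ℕ} :
      Halts Y f (Nat.pair a m) 0 u → Halts Y (.rfind' f) (Nat.pair a m) m u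
  | rfind_next {f : OracleCode} {a m k r u v : ℕ} :
      Halts Y f (Nat.pair a m) (k + 1) u → Halts Y (.rfind' f) (Nat.pair a (m + 1)) r v →
      Halts Y (.rfind' f) (Nat.pair a m) r (max u v)

/-- The output and the oracle-use are determined by the program, the oracle and the input. -/
theorem OracleCode.Halts.unique {Y : ℕ → Bool} {c : OracleCode} {x r u : ℕ}
    (h : OracleCode.Halts Y c x r u) :
    ∀ {r' u' : ℕ}, OracleCode.Halts Y c x r' u' → r = r' ∧ u = u' := by
  induction h with
  | zero | succ | left | right | query => intro r' u' h'; cases h'; exact ⟨rfl, rfl⟩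
  | pair _ _ ih₁ ih₂ =>
    intro r' u' h'
    cases h' with
    | pair h₁ h₂ => obtain ⟨rfl, rfl⟩ := ih₁ h₁; obtain ⟨rfl, rfl⟩ := ih₂ h₂; exact ⟨rfl, rfl⟩
  | comp _ _ ih₁ ih₂ =>
    intro r' u' h'
    cases h' with
    | comp h₁ h₂ => obtain ⟨rfl, rfl⟩ := ih₁ h₁; obtain ⟨rfl, rfl⟩ := ih₂ h₂; exact ⟨rfl, rfl⟩
  | @prec_zero f g a _ _ _ ih =>
    intro r' u' h'
    generalize hx : Nat.pair a 0 = x' at h'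
    cases h' with
    | prec_zero h₁ => obtain ⟨rfl, -⟩ := Nat.pair_eq_pair.1 hx; exact ih h₁
    | prec_succ h₁ h₂ => obtain ⟨-, h0⟩ := Nat.pair_eq_pair.1 hx; omega
  | @prec_succ f g a k _ _ _ _ _ _ ih₁ ih₂ =>
    intro r' u' h'
    generalize hx : Nat.pair a (k + 1) = x' at h'
    cases h' with
    | prec_zero h₁ => obtain ⟨-, h0⟩ := Nat.pair_eq_pair.1 hx; omega
    | prec_succ h₁ h₂ =>
      obtain ⟨rfl, h0⟩ := Nat.pair_eq_pair.1 hx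
      obtain rfl := Nat.succ_injective h0
      obtain ⟨rfl, rfl⟩ := ih₁ h₁; obtain ⟨rfl, rfl⟩ := ih₂ h₂; exact ⟨rfl, rfl⟩
  | @rfind_found f a m _ _ ih =>
    intro r' u' h'
    generalize hx : Nat.pair a m = x' at h'
    cases h' with
    | rfind_found h₁ =>
      obtain ⟨rfl, rfl⟩ := Nat.pair_eq_pair.1 hx; exact ⟨rfl, (ih h₁).2⟩
    | rfind_next h₁ h₂ =>
      obtain ⟨rfl, rfl⟩ := Nat.pair_eq_pair.1 hx; have := (ih h₁).1; omega
  | @rfind_next f a m _ _ _ _ _ _ ih₁ ih₂ =>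
    intro r' u' h'
    generalize hx : Nat.pair a m = x' at h'
    cases h' with
    | rfind_found h₁ =>
      obtain ⟨rfl, rfl⟩ := Nat.pair_eq_pair.1 hx; have := (ih₁ h₁).1; omega
    | rfind_next h₁ h₂ =>
      obtain ⟨rfl, rfl⟩ := Nat.pair_eq_pair.1 hx
      obtain ⟨-, rfl⟩ := ih₁ h₁; obtain ⟨rfl, rfl⟩ := ih₂ h₂; exact ⟨rfl, rfl⟩

/-- `X` is computable from `Y` with oracle-use `g`: one program with oracle `Y` computes, from
each `n`, the first `n` bits of `X`, and the largest position of `Y` that it queries in doing so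
is `g n`. (In particular it only uses the first `g n` bits of `Y`, and `g n` is finite.) -/
def ComputableWithUse (X Y : ℕ → Bool) (g : ℕ → ℕ∞) : Prop :=
  ∃ c : OracleCode, ∀ n : ℕ, ∃ u : ℕ, (u : ℕ∞) = g n ∧
    OracleCode.Halts Y c n (Encodable.encode (initialSegment X n)) u

/-!
Fix stage-by-stage approximations `U_s`, `Ω_s` and `X_s` of `U`, of the halting probability `Ω` of
`V`, and of `X`. For a program `p`, consider the event that `U_s(p)` has halted with an output
that is, at the stage `s`, taken for a prefix of `X`. As the approximations to `X` increase, a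
prefix that is given up does not return; so this event begins at most once and ends at most once.
At a change of the event of `p` at a stage `s`, consider the interval `[Ω_s, Ω_s + 2 ^ (-|p|))`.
By Kraft's inequality the total length of these intervals is at most `2`. Since `Ω` is random, it
lies in only finitely many of them (`IsStaging.finite_setOf_change`). So with finitely many
exceptions `p`, which are dealt with by starting at a late stage, once the first `|p|` bits of
`Ω_s` agree with those of `Ω`, the event of `p` no longer changes
(`exists_forall_prefix_test_correct`).

To compute the first `n` bits of `X`, query the bits of `Ω` one by one. After `u` bits, wait for a
late stage `s` at which `Ω_s` has these first `u` bits; then it is known which programs of length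
at most `u` output prefixes of `X`. If one of those prefixes has length at least `n`, its first
`n` bits are the output; otherwise, query the next bit. The search ends exactly when `u` is
the least `K(X↾i)` with `i ≥ n` (`computableWithUse_of_partrec`).

The randomness of `Ω` is used in the form of Solovay's criterion
(`IsStaging.finite_setOf_haltingProbability_lt`) and is proved directly from the universality of
`V`. Let `[Ω_j, e_j)` be computable intervals of finite total length `w`, and let `c` be
arbitrary. By Markov's inequality, the reals covered at least `N = w * 2 ^ (2 * c)` times have
measure at most `2 ^ (-2 * c)`. Whenever a part of the line to the right of `Ω_j` is covered for
the `N`-th time, `requestMachine` spends `2 ^ c` times its measure on new outputs, up to a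
constant factor. If `V` simulates the machine at a cost of a factor less than `2 ^ c`, then `Ω`
has to grow by at least the measure of that part. As all intervals start to the left of the
current `Ω_j`, what lies to the right of `Ω_j` and is covered `N` times is an interval starting at
`Ω_j`. So `Ω` is driven out of everything that is covered `N` times, and fewer than `N` of the
numbers `e_j` exceed `Ω`.

The same criterion shows that `Ω` is not a dyadic rational, so that its bits are eventually those
of its approximations.
-/

open Encodable

/-! ### Closure properties of computable functions -/

section ComputableArithmetic

variable {α : Type*} [Primcodable α]

theorem Computable.nat_add {f g : α → ℕ} (hf : Computable f) (hg : Computable g) :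
    Computable fun a => f a + g a :=
  Primrec.nat_add.to_comp.comp hf hg

theorem Computable.nat_sub {f g : α → ℕ} (hf : Computable f) (hg : Computable g) :
    Computable fun a => f a - g a :=
  Primrec.nat_sub.to_comp.comp hf hg

theorem Computable.nat_mul {f g : α → ℕ} (hf : Computable f) (hg : Computable g) :
    Computable fun a => f a * g a :=
  Primrec.nat_mul.to_comp.comp hf hg

theorem Computable.nat_div {f g : α → ℕ} (hf : Computable f) (hg : Computable g) :
    Computable fun a => f a / g a :=
  Primrec.nat_div.to_comp.comp hf hg

theorem Computable.two_pow {f : α → ℕ} (hf : Computable f) : Computable fun a => 2 ^ f a :=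
  (Primrec₂.unpaired'.1 Nat.Primrec.pow).to_comp.comp (Computable.const 2) hf

theorem Computable.decide_le {f g : α → ℕ} (hf : Computable f) (hg : Computable g) :
    Computable fun a => decide (f a ≤ g a) :=
  Primrec.nat_le.decide.to_comp.comp hf hg

theorem Computable.decide_lt {f g : α → ℕ} (hf : Computable f) (hg : Computable g) :
    Computable fun a => decide (f a < g a) :=
  Primrec.nat_lt.decide.to_comp.comp hf hg

theorem Computable.decide_eq {β : Type*} [Primcodable β] [DecidableEq β] {f g : α → β}
    (hf : Computable f) (hg : Computable g) : Computable fun a => decide (f a = g a) :=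
  Primrec.eq.decide.to_comp.comp hf hg

theorem Computable.and {f g : α → Bool} (hf : Computable f) (hg : Computable g) :
    Computable fun a => f a && g a :=
  Primrec.and.to_comp.comp hf hg

theorem Computable.option_isSome {β : Type*} [Primcodable β] {f : α → Option β}
    (hf : Computable f) : Computable fun a => (f a).isSome :=
  Primrec.option_isSome.to_comp.comp hf

theorem Computable.bool_toNat {f : α → Bool} (hf : Computable f) :
    Computable fun a => (f a).toNat :=
  (Primrec.dom_bool Bool.toNat).to_comp.comp hf

theorem Computable.sum_range {f : α → ℕ → ℕ} {g : α → ℕ} (hf : Computable₂ f)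
    (hg : Computable g) : Computable fun a => ∑ i ∈ Finset.range (g a), f a i := by
  have h : Computable₂ fun (a : α) (p : ℕ × ℕ) => p.2 + f a p.1 :=
    .nat_add (.comp .snd .snd) (hf.comp .fst (.comp .fst .snd))
  refine (Computable.nat_rec hg (Computable.const 0) h).of_eq fun a => ?_
  induction g a with
  | zero => rfl
  | succ k ih => rw [Finset.sum_range_succ, ← ih]

end ComputableArithmetic

/-! ### Binary strings as numbers -/

/-- The number with binary representation `l`, most significant bit first. -/
def binaryValue (l : List Bool) : ℕ :=
  l.foldl (fun v b => 2 * v + b.toNat) 0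

@[simp]
theorem binaryValue_nil : binaryValue [] = 0 := rfl

@[simp]
theorem binaryValue_concat (l : List Bool) (b : Bool) :
    binaryValue (l ++ [b]) = 2 * binaryValue l + b.toNat := by
  simp [binaryValue]

theorem binaryValue_append (l l' : List Bool) :
    binaryValue (l ++ l') = binaryValue l * 2 ^ l'.length + binaryValue l' := by
  induction l' using List.reverseRecOn with
  | nil => simp
  | append_singleton l' b ih =>
    rw [← List.append_assoc, binaryValue_concat, binaryValue_concat, ih, List.length_append,
      List.length_singleton, pow_succ]
    ring

theorem binaryValue_lt (l : List Bool) : binaryValue l < 2 ^ l.length := by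
  induction l using List.reverseRecOn with
  | nil => simp
  | append_singleton l b ih =>
    rw [binaryValue_concat, List.length_append, List.length_singleton, pow_succ]
    have := b.toNat_le
    omega

theorem binaryValue_injective {l l' : List Bool} (hlen : l.length = l'.length)
    (h : binaryValue l = binaryValue l') : l = l' := by
  induction l using List.reverseRecOn generalizing l' with
  | nil => exact (List.length_eq_zero_iff.1 hlen.symm).symm
  | append_singleton l b ih =>
    rcases List.eq_nil_or_concat l' with rfl | ⟨l', b', rfl⟩
    · simp at hlen
    · rw [List.concat_eq_append] at h hlen ⊢
      simp only [binaryValue_concat] at h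
      simp only [List.length_append, List.length_singleton, Nat.add_right_cancel_iff] at hlen
      have hb := b.toNat_le
      have hb' := b'.toNat_le
      have hbb : b.toNat = b'.toNat := by omega
      have : b = b' := by revert hbb; cases b <;> cases b' <;> decide
      rw [ih hlen (by omega), this]

theorem exists_binaryValue_eq {n z : ℕ} (hz : z < 2 ^ n) :
    ∃ l : List Bool, l.length = n ∧ binaryValue l = z := by
  induction n generalizing z with
  | zero => exact ⟨[], rfl, by simp at hz; simp [hz]⟩
  | succ n ih =>
    obtain ⟨l, hl, hv⟩ := ih (z := z / 2) (by rw [pow_succ] at hz; omega)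
    refine ⟨l ++ [decide (z % 2 = 1)], by simp [hl], ?_⟩
    rcases Nat.mod_two_eq_zero_or_one z with h | h <;> simp [hv, h] <;> omega

theorem primrec_binaryValue : Primrec binaryValue := by
  refine Primrec.list_foldl (h := fun (_ : List Bool) (p : ℕ × Bool) => 2 * p.1 + p.2.toNat)
    .id (.const 0) ?_
  exact Primrec.nat_add.comp (Primrec.nat_mul.comp (.const 2) (.comp .fst .snd))
    (.comp (Primrec.dom_bool _) (.comp .snd .snd))

@[simp]
theorem length_initialSegment (X : ℕ → Bool) (n : ℕ) : (initialSegment X n).length = n := by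
  simp [initialSegment]

theorem initialSegment_succ (X : ℕ → Bool) (n : ℕ) :
    initialSegment X (n + 1) = initialSegment X n ++ [X n] := by
  simp [initialSegment, List.range_succ]

theorem take_initialSegment (X : ℕ → Bool) {m n : ℕ} (h : m ≤ n) :
    (initialSegment X n).take m = initialSegment X m := by
  rw [initialSegment, ← List.map_take, List.take_range, min_eq_left h, initialSegment]

theorem binaryValue_initialSegment_binaryExpansion {x : ℝ} (h1 : x < 1) (n : ℕ) :
    binaryValue (initialSegment (binaryExpansion x) n) = ⌊x * 2 ^ n⌋₊ := by
  induction n with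
  | zero => simpa [initialSegment] using (Nat.floor_eq_zero.2 h1).symm
  | succ n ih =>
    have hdiv : ⌊x * 2 ^ (n + 1)⌋₊ / 2 = ⌊x * 2 ^ n⌋₊ := by
      rw [← Nat.floor_div_ofNat, pow_succ]
      congr 1
      ring
    have hbit : (binaryExpansion x n).toNat = ⌊x * 2 ^ (n + 1)⌋₊ % 2 := by
      have : ∀ a : Fin 2, (finTwoEquiv a).toNat = a := by decide
      rw [binaryExpansion, this, Real.digits, Fin.val_ofNat]
      norm_num
    rw [initialSegment_succ, binaryValue_concat, ih, hbit, ← hdiv]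
    omega

theorem binaryValue_initialSegment_le (X : ℕ → Bool) (n : ℕ) :
    (binaryValue (initialSegment X n) : ℝ) ≤ streamValue X * 2 ^ n ∧
      streamValue X * 2 ^ n ≤ binaryValue (initialSegment X n) + 1 := by
  have hsum : (binaryValue (initialSegment X n) : ℝ) =
      2 ^ n * ∑ i ∈ Finset.range n, Real.ofDigitsTerm (fun n => finTwoEquiv.symm (X n)) i := by
    induction n with
    | zero => simp [initialSegment]
    | succ n ih =>
      have : ∀ b : Bool, ((finTwoEquiv.symm b : Fin 2) : ℕ) = b.toNat := by decide
      rw [initialSegment_succ, binaryValue_concat, Finset.sum_range_succ, Real.ofDigitsTerm]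
      push_cast
      rw [ih, this, pow_succ]
      field_simp
  have h := Real.ofDigits_eq_sum_add_ofDigits (fun n => finTwoEquiv.symm (X n)) n
  have h0 := Real.ofDigits_nonneg (fun i => finTwoEquiv.symm (X (i + n)))
  have h1 := Real.ofDigits_le_one (fun i => finTwoEquiv.symm (X (i + n)))
  rw [hsum, streamValue, h]
  have hp : (0 : ℝ) < 2 ^ n := by positivity
  have e : ((2 : ℝ) ^ n)⁻¹ * 2 ^ n = 1 := by field_simp
  push_cast
  constructor
  · nlinarith [mul_nonneg (inv_nonneg.2 hp.le) h0]
  · nlinarith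

/-! ### Kraft's inequality for prefix-free machines -/

theorem sum_two_inv_pow_length_le_one {S : Finset (List Bool)}
    (hS : ∀ p ∈ S, ∀ q ∈ S, p <+: q → p = q) : ∑ p ∈ S, (2⁻¹ : ℝ) ^ p.length ≤ 1 := by
  by_cases hnil : [] ∈ S
  · have : S = {[]} :=
      Finset.eq_singleton_iff_unique_mem.2 ⟨hnil, fun q hq => (hS _ hnil q hq q.nil_prefix).symm⟩
    simp [this]
  · have hud : InformationTheory.UniquelyDecodable (S : Set (List Bool)) := by
      intro L₁
      induction L₁ with
      | nil =>
        intro L₂ _ h₂ h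
        cases L₂ with
        | nil => rfl
        | cons w L₂ =>
          have hw : w = [] := by
            have := h.symm
            simp only [List.flatten_cons, List.flatten_nil, List.append_eq_nil_iff] at this
            exact this.1
          exact absurd (hw ▸ h₂ w (by simp)) hnil
      | cons v L₁ ih =>
        intro L₂ h₁ h₂ h
        cases L₂ with
        | nil =>
          have hv : v = [] := by
            simp only [List.flatten_cons, List.flatten_nil, List.append_eq_nil_iff] at h
            exact h.1
          exact absurd (hv ▸ h₁ v (by simp)) hnil
        | cons w L₂ =>
          have hv : v ∈ S := h₁ v (by simp)
          have hw : w ∈ S := h₂ w (by simp)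
          simp only [List.flatten_cons] at h
          -- Both `v` and `w` are prefixes of the same string, so one is a prefix of the other.
          have hvw : v = w := by
            rcases List.prefix_or_prefix_of_prefix (List.prefix_append v L₁.flatten)
              (h ▸ List.prefix_append w L₂.flatten) with hp | hp
            · exact hS v hv w hw hp
            · exact (hS w hw v hv hp).symm
          subst hvw
          rw [ih L₂ (fun x hx => h₁ x (by simp [hx])) (fun x hx => h₂ x (by simp [hx]))
            (List.append_cancel_left h)]
    simpa using InformationTheory.kraft_mcmillan_inequality hud

section Kraft

variable {M : List Bool →. List Bool}

theorem IsPrefixFreeMachine.sum_le_one (hM : IsPrefixFreeMachine M) {S : Finset (List Bool)}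
    (hS : ∀ p ∈ S, (M p).Dom) : ∑ p ∈ S, (2⁻¹ : ℝ) ^ p.length ≤ 1 :=
  sum_two_inv_pow_length_le_one fun p hp q hq => hM.prefixFree p q (hS p hp) (hS q hq)

theorem IsPrefixFreeMachine.summable (hM : IsPrefixFreeMachine M) :
    Summable fun p : {p : List Bool // (M p).Dom} => (2⁻¹ : ℝ) ^ (p : List Bool).length := by
  refine summable_of_sum_le (c := 1) (fun p => by positivity) fun S => ?_
  have := hM.sum_le_one (S := S.map (Function.Embedding.subtype _)) (by simp +contextual)
  simpa using this

theorem IsPrefixFreeMachine.sum_le_haltingProbability (hM : IsPrefixFreeMachine M)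
    {S : Finset (List Bool)} (hS : ∀ p ∈ S, (M p).Dom) :
    ∑ p ∈ S, (2⁻¹ : ℝ) ^ p.length ≤ haltingProbability M := by
  classical
  have h := hM.summable.sum_le_tsum (S.subtype fun p => (M p).Dom) (fun p _ => by positivity)
  rwa [Finset.sum_subtype_of_mem (fun p : List Bool => (2⁻¹ : ℝ) ^ p.length) hS] at h

theorem IsPrefixFreeMachine.haltingProbability_le_one (hM : IsPrefixFreeMachine M) :
    haltingProbability M ≤ 1 := by
  refine hM.summable.tsum_le_of_sum_le fun S => ?_
  have := hM.sum_le_one (S := S.map (Function.Embedding.subtype _)) (by simp +contextual)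
  simpa using this

theorem IsPrefixFreeMachine.exists_sum_gt (hM : IsPrefixFreeMachine M) {r : ℝ}
    (hr : r < haltingProbability M) :
    ∃ S : Finset (List Bool), (∀ p ∈ S, (M p).Dom) ∧ r < ∑ p ∈ S, (2⁻¹ : ℝ) ^ p.length := by
  obtain ⟨S, hS⟩ := (hM.summable.hasSum.eventually_const_lt hr).exists
  exact ⟨S.map (Function.Embedding.subtype _), by simp +contextual, by simpa using hS⟩

end Kraft

/-! ### Computable approximation of machines from below -/

/-- Stages of a computation of the machine `M`: a computable sequence of finite parts of `M`, which
increases to `M`. At the stage `t`, only programs with code less than `t` have halted. -/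
structure IsStaging (M : List Bool →. List Bool) (f : ℕ → List Bool → Option (List Bool)) :
    Prop where
  computable : Computable₂ f
  mono : ∀ {s t p σ}, s ≤ t → f s p = some σ → f t p = some σ
  sound : ∀ {t p σ}, f t p = some σ → σ ∈ M p
  complete : ∀ {p σ}, σ ∈ M p → ∃ t, f t p = some σ
  bound : ∀ {t p σ}, f t p = some σ → encode p < t

theorem exists_isStaging {M : List Bool →. List Bool} (hM : Partrec M) : ∃ f, IsStaging M f := by
  obtain ⟨c, hc⟩ := Nat.Partrec.Code.exists_code.1 hM
  have hev (p : List Bool) : c.eval (encode p) = (M p).map encode := by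
    rw [hc]
    simp
  have hdec {t : ℕ} {p σ : List Bool}
      (h : (Nat.Partrec.Code.evaln t c (encode p)).bind (decode (α := List Bool)) = some σ) :
      encode σ ∈ Nat.Partrec.Code.evaln t c (encode p) := by
    obtain ⟨x, hx, hxσ⟩ := Option.bind_eq_some_iff.1 h
    have := Nat.Partrec.Code.evaln_sound hx
    rw [hev] at this
    obtain ⟨τ, -, rfl⟩ := (Part.mem_map_iff _).1 this
    rw [encodek] at hxσ
    cases hxσ
    exact hx
  have henc {t : ℕ} {p σ : List Bool} (h : encode σ ∈ Nat.Partrec.Code.evaln t c (encode p)) :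
      (Nat.Partrec.Code.evaln t c (encode p)).bind (decode (α := List Bool)) = some σ :=
    Option.bind_eq_some_iff.2 ⟨_, h, encodek σ⟩
  refine ⟨fun t p => (Nat.Partrec.Code.evaln t c (encode p)).bind decode, ?_, ?_, ?_, ?_, ?_⟩
  · refine Computable.option_bind ?_ (Computable.decode.comp .snd).to₂
    exact Nat.Partrec.Code.primrec_evaln.to_comp.comp
      (.pair (.pair .fst (.const c)) (Computable.encode.comp .snd))
  · exact fun hst h => henc (Nat.Partrec.Code.evaln_mono hst (hdec h))
  · intro t p σ h
    have := Nat.Partrec.Code.evaln_sound (hdec h)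
    rw [hev] at this
    obtain ⟨τ, hτ, he⟩ := (Part.mem_map_iff _).1 this
    rwa [← encode_injective he]
  · intro p σ h
    have : encode σ ∈ c.eval (encode p) := by
      rw [hev]
      exact Part.mem_map _ h
    obtain ⟨t, ht⟩ := Nat.Partrec.Code.evaln_complete.1 this
    exact ⟨t, henc ht⟩
  · exact fun h => Nat.Partrec.Code.evaln_bound (hdec h)

/-- The finite set of the strings with code less than `t`. -/
noncomputable def stringsBelow (t : ℕ) : Finset (List Bool) :=
  (Finset.range t).preimage encode encode_injective.injOn

@[simp]
theorem mem_stringsBelow {t : ℕ} {p : List Bool} : p ∈ stringsBelow t ↔ encode p < t := by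
  simp [stringsBelow]

theorem stringsBelow_mono : Monotone stringsBelow :=
  fun _ _ h _ hp => mem_stringsBelow.2 ((mem_stringsBelow.1 hp).trans_le h)

theorem sum_stringsBelow {β : Type*} [AddCommMonoid β] (g : List Bool → β) (t : ℕ) :
    ∑ p ∈ stringsBelow t, g p =
      ∑ n ∈ Finset.range t, (decode₂ (List Bool) n).elim 0 g := by
  rw [stringsBelow,
    ← Finset.sum_preimage (encode : List Bool → ℕ) (Finset.range t) encode_injective.injOn]
  · exact Finset.sum_congr rfl fun p _ => by simp
  · intro n _ hn
    have : decode₂ (List Bool) n = none := by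
      rw [Option.eq_none_iff_forall_not_mem]
      exact fun p hp => hn ⟨p, mem_decode₂.1 hp⟩
    simp [this]

theorem Computable.sum_stringsBelow {α : Type*} [Primcodable α] {g : α → List Bool → ℕ}
    {h : α → ℕ} (hg : Computable₂ g) (hh : Computable h) :
    Computable fun a => ∑ p ∈ stringsBelow (h a), g a p := by
  simp only [_root_.sum_stringsBelow]
  refine Computable.sum_range (f := fun a n => (decode₂ (List Bool) n).elim 0 (g a)) ?_ hh
  have : Computable₂ fun (a : α × ℕ) (p : List Bool) => g a.1 p :=
    hg.comp (.comp .fst .fst) .snd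
  refine (Computable.option_casesOn (Primrec.decode₂.to_comp.comp .snd) (.const 0) this).of_eq ?_
  rintro ⟨a, n⟩
  change _ = (decode₂ (List Bool) n).elim 0 (g a)
  cases decode₂ (List Bool) n <;> rfl

section Staging

variable {V : List Bool →. List Bool} {f : ℕ → List Bool → Option (List Bool)}

/-- The programs that have halted by the stage `t`. -/
noncomputable def haltedBy (f : ℕ → List Bool → Option (List Bool)) (t : ℕ) : Finset (List Bool) :=
  (stringsBelow t).filter fun p => (f t p).isSome

/-- The halting probability at the stage `t`, as a multiple of `2⁻ᵗ`. -/
noncomputable def stageNumerator (f : ℕ → List Bool → Option (List Bool)) (t : ℕ) : ℕ :=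
  ∑ p ∈ haltedBy f t, 2 ^ (t - p.length)

/-- A bound for the lengths of the outputs of the programs that have halted by the stage `t`. -/
noncomputable def outputBound (f : ℕ → List Bool → Option (List Bool)) (t : ℕ) : ℕ :=
  ∑ p ∈ stringsBelow t, ((f t p).map List.length).getD 0

namespace IsStaging

theorem mem_haltedBy (hf : IsStaging V f) {t : ℕ} {p : List Bool} :
    p ∈ haltedBy f t ↔ ∃ σ, f t p = some σ := by
  simp only [haltedBy, Finset.mem_filter, mem_stringsBelow, Option.isSome_iff_exists]
  exact ⟨fun h => h.2, fun h => ⟨hf.bound h.choose_spec, h⟩⟩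

theorem haltedBy_mono (hf : IsStaging V f) : Monotone (haltedBy f) := fun s t hst p hp => by
  obtain ⟨σ, hσ⟩ := hf.mem_haltedBy.1 hp
  exact hf.mem_haltedBy.2 ⟨σ, hf.mono hst hσ⟩

theorem dom_of_mem_haltedBy (hf : IsStaging V f) {t : ℕ} {p : List Bool}
    (hp : p ∈ haltedBy f t) : (V p).Dom := by
  obtain ⟨σ, hσ⟩ := hf.mem_haltedBy.1 hp
  exact (hf.sound hσ).1

theorem exists_mem_haltedBy (hf : IsStaging V f) {p : List Bool} (hp : (V p).Dom) :
    ∃ t, p ∈ haltedBy f t := by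
  obtain ⟨t, ht⟩ := hf.complete (Part.get_mem hp)
  exact ⟨t, hf.mem_haltedBy.2 ⟨_, ht⟩⟩

theorem length_le_of_mem_haltedBy {t : ℕ} {p : List Bool} (hp : p ∈ haltedBy f t) :
    p.length ≤ t :=
  (length_le_encode p).trans (mem_stringsBelow.1 (Finset.mem_filter.1 hp).1).le

theorem computable_stageNumerator (hf : IsStaging V f) : Computable (stageNumerator f) := by
  have : Computable fun t => ∑ p ∈ stringsBelow t,
      (f t p).isSome.toNat * 2 ^ (t - p.length) := by
    refine Computable.sum_stringsBelow
      (g := fun t p => (f t p).isSome.toNat * 2 ^ (t - p.length)) ?_ .id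
    exact Computable.nat_mul (.bool_toNat (.option_isSome hf.computable))
      (.two_pow (.nat_sub .fst (Computable.list_length.comp .snd)))
  refine this.of_eq fun t => ?_
  rw [stageNumerator, haltedBy, Finset.sum_filter]
  exact Finset.sum_congr rfl fun p _ => by cases (f t p).isSome <;> simp

theorem stageNumerator_div (t : ℕ) :
    (stageNumerator f t : ℝ) / 2 ^ t = ∑ p ∈ haltedBy f t, (2⁻¹ : ℝ) ^ p.length := by
  rw [stageNumerator, Nat.cast_sum, Finset.sum_div]
  refine Finset.sum_congr rfl fun p hp => ?_
  have := length_le_of_mem_haltedBy hp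
  rw [Nat.cast_pow, Nat.cast_ofNat, pow_sub₀ _ two_ne_zero this, inv_pow]
  field_simp

theorem monotone_stageNumerator_div (hf : IsStaging V f) :
    Monotone fun t => (stageNumerator f t : ℝ) / 2 ^ t := fun s t hst => by
  simp only [stageNumerator_div]
  exact Finset.sum_le_sum_of_subset_of_nonneg (hf.haltedBy_mono hst) fun _ _ _ => by positivity

theorem exists_lt_stageNumerator_div (hf : IsStaging V f) (hV : IsPrefixFreeMachine V) {r : ℝ}
    (hr : r < haltingProbability V) : ∃ t, r < (stageNumerator f t : ℝ) / 2 ^ t := by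
  obtain ⟨S, hS, hlt⟩ := hV.exists_sum_gt hr
  choose! T hT using fun p hp => hf.exists_mem_haltedBy (hS p hp)
  refine ⟨S.sup T, hlt.trans_le ?_⟩
  rw [stageNumerator_div]
  exact Finset.sum_le_sum_of_subset_of_nonneg
    (fun p hp => hf.haltedBy_mono (Finset.le_sup hp) (hT p hp)) fun _ _ _ => by positivity

theorem computable_outputBound (hf : IsStaging V f) : Computable (outputBound f) := by
  refine Computable.sum_stringsBelow (g := fun t p => ((f t p).map List.length).getD 0) ?_ .id
  exact Computable.option_getD
    (Computable.option_map hf.computable (Computable.list_length.comp .snd).to₂) (.const 0)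

theorem monotone_outputBound (hf : IsStaging V f) : Monotone (outputBound f) := fun s t hst => by
  refine (Finset.sum_le_sum fun p _ => ?_).trans
    (Finset.sum_le_sum_of_subset (stringsBelow_mono hst))
  cases h : f s p with
  | none => simp
  | some σ => simp [hf.mono hst h]

theorem length_le_outputBound (hf : IsStaging V f) {t : ℕ} {p σ : List Bool}
    (h : f t p = some σ) : σ.length ≤ outputBound f t := by
  refine le_trans ?_ (Finset.single_le_sum (f := fun p => ((f t p).map List.length).getD 0)
    (fun _ _ => Nat.zero_le _) (mem_stringsBelow.2 (hf.bound h)))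
  simp [h]

/-- Programs with outputs longer than `outputBound f t` have not halted by the stage `t`, so that
their weight is still missing in the halting probability at the stage `t`. -/
theorem stageNumerator_div_add_sum_le (hf : IsStaging V f) (hV : IsPrefixFreeMachine V) {t : ℕ}
    {Q : Finset (List Bool)} (hQ : ∀ q ∈ Q, ∃ σ ∈ V q, outputBound f t < σ.length) :
    (stageNumerator f t : ℝ) / 2 ^ t + ∑ q ∈ Q, (2⁻¹ : ℝ) ^ q.length ≤
      haltingProbability V := by
  have hdisj : Disjoint (haltedBy f t) Q := by
    rw [Finset.disjoint_left]
    intro q hq hqQ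
    obtain ⟨τ, hτ⟩ := hf.mem_haltedBy.1 hq
    obtain ⟨σ, hσ, hlt⟩ := hQ q hqQ
    rw [Part.mem_unique hσ (hf.sound hτ)] at hlt
    exact hlt.not_ge (hf.length_le_outputBound hτ)
  rw [stageNumerator_div, ← Finset.sum_union hdisj]
  refine hV.sum_le_haltingProbability fun p hp => ?_
  rcases Finset.mem_union.1 hp with hp | hp
  · exact hf.dom_of_mem_haltedBy hp
  · obtain ⟨σ, hσ, -⟩ := hQ p hp
    exact hσ.1

theorem stageNumerator_div_le (hf : IsStaging V f) (hV : IsPrefixFreeMachine V) (t : ℕ) :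
    (stageNumerator f t : ℝ) / 2 ^ t ≤ haltingProbability V := by
  simpa using hf.stageNumerator_div_add_sum_le hV (t := t) (Q := ∅) (by simp)

end IsStaging

end Staging

/-! ### Counting how often a dyadic interval is covered -/

section Cover

variable (O E : ℕ → ℕ) (N : ℕ)

/-- The number of `i < k` such that the interval `[y / 2 ^ J, (y + 1) / 2 ^ J)` lies to the left of
`E i / 2 ^ i` (for `k ≤ J + 1`). -/
def coverCount (J k y : ℕ) : ℕ :=
  ((Finset.range k).filter fun i => y < E i * 2 ^ (J - i)).card

/-- The dyadic intervals of length `2⁻ᴶ`, given by their left endpoints as multiples of `2⁻ᴶ`, that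
lie in `[O i / 2 ^ i, E i / 2 ^ i)` and to the left of exactly `N - 1` of the points
`E 0 / 2 ^ 0, …, E (i - 1) / 2 ^ (i - 1)`. So `i` is the index at which they are covered for
the `N`-th time. -/
def newCells (J i : ℕ) : Finset ℕ :=
  (Finset.range (E i * 2 ^ (J - i))).filter fun y =>
    O i * 2 ^ (J - i) ≤ y ∧ coverCount E J i y + 1 = N

/-- The measure of the intervals covered for the `N`-th time before the index `j`, as a multiple
of `2⁻ʲ`. -/
def requestStart (j : ℕ) : ℕ :=
  ∑ i ∈ Finset.range j, (newCells O E N i i).card * 2 ^ (j - i)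

variable {O E N}

theorem mem_newCells {J i y : ℕ} : y ∈ newCells O E N J i ↔
    y < E i * 2 ^ (J - i) ∧ O i * 2 ^ (J - i) ≤ y ∧ coverCount E J i y + 1 = N := by
  simp [newCells]

theorem coverCount_succ (J k y : ℕ) : coverCount E J (k + 1) y =
    coverCount E J k y + if y < E k * 2 ^ (J - k) then 1 else 0 := by
  rw [coverCount, coverCount, Finset.range_add_one, Finset.filter_insert]
  split_ifs <;> simp

theorem coverCount_mono (J y : ℕ) : Monotone fun k => coverCount E J k y := fun _ _ h =>
  Finset.card_le_card (Finset.filter_subset_filter _ (Finset.range_subset_range.2 h))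

theorem coverCount_antitone (J k : ℕ) : Antitone (coverCount E J k) := fun _ _ h =>
  Finset.card_le_card (Finset.monotone_filter_right _ fun _ _ hi => h.trans_lt hi)

/-- The count for the points with index less than `k` can be read off from coarser intervals, as
these points are multiples of `2⁻ⁱ`. -/
theorem coverCount_eq_div {J k i y : ℕ} (hki : k ≤ i) (hiJ : i ≤ J) :
    coverCount E J k y = coverCount E i k (y / 2 ^ (J - i)) := by
  refine congr_arg Finset.card (Finset.filter_congr fun i' hi' => ?_)
  have hi' := Finset.mem_range.1 hi'
  rw [Nat.div_lt_iff_lt_mul (by positivity), mul_assoc, ← pow_add]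
  congr! 3
  omega

theorem mem_newCells_iff_div {J i y : ℕ} (hiJ : i ≤ J) :
    y ∈ newCells O E N J i ↔ y / 2 ^ (J - i) ∈ newCells O E N i i := by
  rw [mem_newCells, mem_newCells, coverCount_eq_div le_rfl hiJ, Nat.sub_self, pow_zero, mul_one,
    mul_one, Nat.div_lt_iff_lt_mul (by positivity), Nat.le_div_iff_mul_le (by positivity)]

theorem card_eq_mul_of_mem_iff_div {S T : Finset ℕ} {m : ℕ} (hm : 0 < m)
    (h : ∀ y, y ∈ T ↔ y / m ∈ S) : T.card = S.card * m := by
  rw [Finset.card_eq_sum_card_fiberwise (f := (· / m)) (t := S) fun y hy => (h y).1 hy,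
    Finset.sum_const_nat]
  intro s hs
  have : T.filter (fun y => y / m = s) = Finset.Ico (s * m) (s * m + m) := by
    ext y
    rw [Finset.mem_filter, Finset.mem_Ico, h, Nat.div_eq_iff hm]
    constructor
    · rintro ⟨-, h1, h2⟩
      omega
    · rintro ⟨h1, h2⟩
      have : y / m = s := (Nat.div_eq_iff hm).2 (by omega)
      exact ⟨this ▸ hs, by omega⟩
  rw [this, Nat.card_Ico]
  omega

theorem card_newCells {J i : ℕ} (hiJ : i ≤ J) :
    (newCells O E N J i).card = (newCells O E N i i).card * 2 ^ (J - i) :=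
  card_eq_mul_of_mem_iff_div (by positivity) fun _ => mem_newCells_iff_div hiJ

theorem disjoint_newCells {J i i' : ℕ} (h : i < i') :
    Disjoint (newCells O E N J i) (newCells O E N J i') := by
  rw [Finset.disjoint_left]
  intro y hy hy'
  obtain ⟨hlt, -, hN⟩ := mem_newCells.1 hy
  obtain ⟨-, -, hN'⟩ := mem_newCells.1 hy'
  have h1 : coverCount E J (i + 1) y = coverCount E J i y + 1 := by
    rw [coverCount_succ, if_pos hlt]
  have h2 : coverCount E J (i + 1) y ≤ coverCount E J i' y := coverCount_mono J y h
  omega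

theorem mul_two_pow_le_mul_two_pow (hO : Monotone fun j => (O j : ℝ) / 2 ^ j) {i j J : ℕ}
    (hij : i ≤ j) (hjJ : j ≤ J) : O i * 2 ^ (J - i) ≤ O j * 2 ^ (J - j) := by
  have h : (O i : ℝ) / 2 ^ i ≤ O j / 2 ^ j := hO hij
  have h' : (O i : ℝ) / 2 ^ i * 2 ^ J ≤ O j / 2 ^ j * 2 ^ J := by gcongr
  have e {k : ℕ} (hk : k ≤ J) : (O k : ℝ) / 2 ^ k * 2 ^ J = O k * 2 ^ (J - k) := by
    rw [pow_sub₀ _ two_ne_zero hk]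
    field_simp
  rw [e (hij.trans hjJ), e hjJ] at h'
  exact_mod_cast h'

/-- Markov's inequality: the measure of what is covered `N` times is at most `N⁻¹` times the sum of
the measures of the covering intervals. -/
theorem mul_sum_card_newCells_le (hO : Monotone fun j => (O j : ℝ) / 2 ^ j) (J : ℕ) :
    N * ∑ i ∈ Finset.range J, (newCells O E N J i).card ≤
      ∑ i ∈ Finset.range J, (E i - O i) * 2 ^ (J - i) := by
  set I : ℕ → Finset ℕ := fun i => Finset.Ico (O i * 2 ^ (J - i)) (E i * 2 ^ (J - i)) with hI
  set S := (Finset.range J).biUnion (newCells O E N J) with hS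
  have hcard : S.card = ∑ i ∈ Finset.range J, (newCells O E N J i).card := by
    refine Finset.card_biUnion fun i _ i' _ hne => ?_
    rcases lt_or_gt_of_ne hne with h | h
    · exact disjoint_newCells h
    · exact (disjoint_newCells h).symm
  have hle : ∀ y ∈ S, N ≤ ((Finset.range J).bipartiteBelow (fun i y => y ∈ I i) y).card := by
    intro y hy
    obtain ⟨i, hi, hyi⟩ := Finset.mem_biUnion.1 hy
    have hi := Finset.mem_range.1 hi
    obtain ⟨hlt, hOy, hN⟩ := mem_newCells.1 hyi
    have : coverCount E J (i + 1) y = N := by rw [coverCount_succ, if_pos hlt, hN]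
    rw [← this]
    refine Finset.card_le_card fun k hk => ?_
    obtain ⟨hk, hky⟩ := Finset.mem_filter.1 hk
    have hk := Finset.mem_range.1 hk
    refine Finset.mem_filter.2 ⟨Finset.mem_range.2 (by omega), Finset.mem_Ico.2 ⟨?_, hky⟩⟩
    exact (mul_two_pow_le_mul_two_pow hO (by omega) hi.le).trans hOy
  calc N * ∑ i ∈ Finset.range J, (newCells O E N J i).card = ∑ y ∈ S, N := by
        rw [Finset.sum_const, smul_eq_mul, hcard, mul_comm]
    _ ≤ ∑ y ∈ S, ((Finset.range J).bipartiteBelow (fun i y => y ∈ I i) y).card :=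
        Finset.sum_le_sum hle
    _ = ∑ i ∈ Finset.range J, (S.bipartiteAbove (fun i y => y ∈ I i) i).card :=
        (Finset.sum_card_bipartiteAbove_eq_sum_card_bipartiteBelow _).symm
    _ ≤ ∑ i ∈ Finset.range J, (E i - O i) * 2 ^ (J - i) := by
        refine Finset.sum_le_sum fun i _ => ?_
        rw [Nat.sub_mul, ← Nat.card_Ico]
        exact Finset.card_le_card fun y hy => (Finset.mem_filter.1 hy).2

theorem two_mul_requestStart_add (j : ℕ) :
    2 * (requestStart O E N j + (newCells O E N j j).card) =
      ∑ i ∈ Finset.range (j + 1), (newCells O E N (j + 1) i).card := by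
  rw [Finset.sum_range_succ, card_newCells j.le_succ, requestStart, mul_add, Finset.mul_sum]
  congr 1
  · refine Finset.sum_congr rfl fun i hi => ?_
    have hi := Finset.mem_range.1 hi
    rw [card_newCells (J := j + 1) (by omega), Nat.sub_add_comm hi.le, pow_succ]
    ring
  · simp [mul_comm]

/-- The requests up to the index `j` occupy positions of total measure at most `2 ^ W / N`. -/
theorem mul_requestStart_add_le (hO : Monotone fun j => (O j : ℝ) / 2 ^ j) {W : ℕ}
    (hW : ∀ J, ∑ j ∈ Finset.range J, ((E j - O j : ℕ) : ℝ) / 2 ^ j ≤ 2 ^ W) (j : ℕ) :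
    N * (requestStart O E N j + (newCells O E N j j).card) ≤ 2 ^ (j + W) := by
  have h := mul_sum_card_newCells_le (N := N) (E := E) hO (j + 1)
  rw [← two_mul_requestStart_add] at h
  have h' : ∑ i ∈ Finset.range (j + 1), (E i - O i) * 2 ^ (j + 1 - i) ≤ 2 ^ (j + 1 + W) := by
    have := mul_le_mul_of_nonneg_left (hW (j + 1)) (by positivity : (0 : ℝ) ≤ 2 ^ (j + 1))
    rw [Finset.mul_sum, ← pow_add] at this
    rw [← Nat.cast_le (α := ℝ), Nat.cast_sum]
    push_cast at this ⊢
    refine le_trans (le_of_eq (Finset.sum_congr rfl fun i hi => ?_)) this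
    have hi := Finset.mem_range.1 hi
    rw [pow_sub₀ _ two_ne_zero (by omega)]
    field_simp
  have e : (2 : ℕ) ^ (j + 1 + W) = 2 * 2 ^ (j + W) := by
    rw [← pow_succ']
    congr 1
    omega
  rw [e] at h'
  have := h.trans h'
  nlinarith

/-- The positions of the requests of an earlier index lie below those of a later one. -/
theorem requestStart_add_mul_le {j j' : ℕ} (h : j < j') :
    (requestStart O E N j + (newCells O E N j j).card) * 2 ^ (j' - j) ≤ requestStart O E N j' := by
  have : (requestStart O E N j + (newCells O E N j j).card) * 2 ^ (j' - j) =
      ∑ i ∈ Finset.range (j + 1), (newCells O E N i i).card * 2 ^ (j' - i) := by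
    rw [Finset.sum_range_succ, requestStart, add_mul, Finset.sum_mul]
    congr 1
    refine Finset.sum_congr rfl fun i hi => ?_
    have hi := Finset.mem_range.1 hi
    rw [mul_assoc, ← pow_add]
    congr 2
    omega
  rw [this]
  exact Finset.sum_le_sum_of_subset (Finset.range_subset_range.2 h)

/-- If `N` of the points `E i / 2 ^ i` with `i ≤ J` lie to the right of the interval `y` of length
`2⁻ᴶ`, then from some index `t` on, the intervals covered for the `N`-th time at an index in
`[t, J]` fill up everything from `O t / 2 ^ t` to the right end of `y`. -/
theorem exists_le_sum_card_newCells {J y : ℕ} (hN : 0 < N) (hy : N ≤ coverCount E J (J + 1) y) :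
    ∃ t ≤ J, y + 1 ≤ O t * 2 ^ (J - t) + ∑ j ∈ Finset.Icc t J, (newCells O E N J j).card := by
  classical
  -- The last stage at which the current point `O t / 2 ^ t` is not yet covered `N` times.
  obtain ⟨t, htJ, ht, hlast⟩ : ∃ t ≤ J, coverCount E t t (O t) < N ∧
      ∀ j, t < j → j ≤ J → N ≤ coverCount E j j (O j) := by
    refine ⟨Nat.findGreatest (fun t => coverCount E t t (O t) < N) J, Nat.findGreatest_le J,
      Nat.findGreatest_spec (P := fun t => coverCount E t t (O t) < N) (Nat.zero_le J)
        (by simpa [coverCount] using hN), fun j hj hjJ => ?_⟩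
    exact not_lt.1 (Nat.findGreatest_is_greatest
      (P := fun t => coverCount E t t (O t) < N) hj hjJ)
  refine ⟨t, htJ, ?_⟩
  have hsub : Finset.Ico (O t * 2 ^ (J - t)) (y + 1) ⊆
      (Finset.Icc t J).biUnion (newCells O E N J) := by
    intro x hx
    obtain ⟨hOx, hxy⟩ := Finset.mem_Ico.1 hx
    have hxJ : N ≤ coverCount E J (J + 1) x :=
      hy.trans (coverCount_antitone J (J + 1) (Nat.lt_succ_iff.1 hxy))
    have hlevel {j : ℕ} (hj : j ≤ J) :
        coverCount E j j (O j) = coverCount E J j (O j * 2 ^ (J - j)) := by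
      rw [coverCount_eq_div le_rfl hj, Nat.mul_div_cancel _ (by positivity)]
    have hxt : coverCount E J t x < N := by
      refine (coverCount_antitone J t hOx).trans_lt ?_
      rwa [← hlevel htJ]
    -- The index at which `x` is covered for the `N`-th time.
    have hex : ∃ j, N ≤ coverCount E J (j + 1) x := ⟨J, hxJ⟩
    set j := Nat.find hex with hj
    have hjN : N ≤ coverCount E J (j + 1) x := Nat.find_spec hex
    have hjJ : j ≤ J := Nat.find_min' hex hxJ
    have htj : t ≤ j := by
      by_contra hlt
      exact (hjN.trans (coverCount_mono J x (by omega : j + 1 ≤ t))).not_gt hxt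
    have hjlt : coverCount E J j x < N := by
      rcases htj.eq_or_lt with h | h
      · rwa [← h]
      · have := Nat.find_min hex (m := j - 1) (by omega)
        rwa [Nat.sub_add_cancel (by omega), not_le] at this
    refine Finset.mem_biUnion.2 ⟨j, Finset.mem_Icc.2 ⟨htj, hjJ⟩, mem_newCells.2 ?_⟩
    rw [coverCount_succ] at hjN
    have hxE : x < E j * 2 ^ (J - j) := by
      by_contra hno
      rw [if_neg hno] at hjN
      omega
    rw [if_pos hxE] at hjN
    refine ⟨hxE, ?_, by omega⟩
    rcases htj.eq_or_lt with h | h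
    · rwa [← h]
    · by_contra hlt
      have h1 := hlast j h hjJ
      rw [hlevel hjJ] at h1
      exact (h1.trans (coverCount_antitone J j (not_le.1 hlt).le)).not_gt hjlt
  have := (Finset.card_le_card hsub).trans Finset.card_biUnion_le
  rw [Nat.card_Ico] at this
  omega

theorem computable_coverCount {α : Type*} [Primcodable α] {J k y : α → ℕ} (hE : Computable E)
    (hJ : Computable J) (hk : Computable k) (hy : Computable y) :
    Computable fun a => coverCount E (J a) (k a) (y a) := by
  have : Computable₂ fun (a : α) (i : ℕ) => (decide (y a < E i * 2 ^ (J a - i))).toNat :=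
    .bool_toNat (.decide_lt (hy.comp .fst)
      (.nat_mul (hE.comp .snd) (.two_pow (.nat_sub (hJ.comp .fst) .snd))))
  refine (Computable.sum_range this hk).of_eq fun a => ?_
  rw [coverCount, Finset.card_filter]
  exact Finset.sum_congr rfl fun i _ => by split_ifs with h <;> simp [h]

theorem computable_card_newCells {α : Type*} [Primcodable α] {n j : α → ℕ} (hO : Computable O)
    (hE : Computable E) (hn : Computable n) (hj : Computable j) :
    Computable fun a => (newCells O E (n a) (j a) (j a)).card := by
  have : Computable₂ fun (a : α) (y : ℕ) =>
      (decide (O (j a) ≤ y) && decide (coverCount E (j a) (j a) y + 1 = n a)).toNat :=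
    .bool_toNat (.and (.decide_le (hO.comp (hj.comp .fst)) .snd)
      (.decide_eq (.nat_add (computable_coverCount hE (hj.comp .fst) (hj.comp .fst) .snd)
        (.const 1)) (hn.comp .fst)))
  refine (Computable.sum_range this (hE.comp hj)).of_eq fun a => ?_
  rw [newCells, Finset.card_filter, Nat.sub_self, pow_zero, mul_one, mul_one]
  refine Finset.sum_congr rfl fun y _ => ?_
  rw [← Bool.decide_and]
  split_ifs with h <;> simp [h]

theorem computable_requestStart {α : Type*} [Primcodable α] {n j : α → ℕ} (hO : Computable O)
    (hE : Computable E) (hn : Computable n) (hj : Computable j) :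
    Computable fun a => requestStart O E (n a) (j a) :=
  Computable.sum_range (f := fun a i => (newCells O E (n a) i i).card * 2 ^ (j a - i))
    (.nat_mul (computable_card_newCells hO hE (hn.comp .fst) .snd)
      (.two_pow (.nat_sub (hj.comp .fst) .snd))) hj

end Cover

/-! ### The halting probability avoids computable null covers -/

section RequestMachine

/-- The program for `requestMachine` with parameters `c` and `l`. -/
def requestProgram (c : ℕ) (l : List Bool) : List Bool :=
  List.replicate c false ++ true :: l

/-- The machine that, for each `c`, requests new outputs for the intervals covered for the `N`-th
time, where `N = 2 ^ (2 * c + W)`. The intervals are stacked on top of each other: those of the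
index `j` occupy the positions from `requestStart O E N j` on, in units of `2⁻ʲ`. A program consists
of `c` and of the binary representation of such a position with `j - 2 * c` digits, so that
its length determines `j`. The outputs are pairwise distinct and longer than `L j`. -/
def requestMachine (O E L : ℕ → ℕ) (W : ℕ) (p : List Bool) : Option (List Bool) :=
  let c := p.idxOf true
  let l := p.drop (c + 1)
  let j := l.length + 2 * c
  let N := 2 ^ (2 * c + W)
  bif decide (c < p.length) && (decide (requestStart O E N j ≤ binaryValue l) &&
      decide (binaryValue l < requestStart O E N j + (newCells O E N j j).card))
  then some (List.replicate (L j) false ++ true :: p) else none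

variable {O E L : ℕ → ℕ} {W : ℕ}

theorem length_requestProgram (c : ℕ) (l : List Bool) :
    (requestProgram c l).length = c + 1 + l.length := by
  simp [requestProgram]
  omega

theorem idxOf_requestProgram (c : ℕ) (l : List Bool) : (requestProgram c l).idxOf true = c := by
  rw [requestProgram, List.idxOf_append_of_notMem (by simp)]
  simp

theorem drop_requestProgram (c : ℕ) (l : List Bool) : (requestProgram c l).drop (c + 1) = l := by
  simp [requestProgram, List.drop_append]

theorem exists_eq_requestProgram {p : List Bool} (h : p.idxOf true < p.length) :
    ∃ c l, p = requestProgram c l := by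
  induction p with
  | nil => simp at h
  | cons b p ih =>
    cases b with
    | true => exact ⟨0, p, rfl⟩
    | false =>
      obtain ⟨c, l, rfl⟩ := ih (by simpa [List.idxOf_cons] using h)
      exact ⟨c + 1, l, by simp [requestProgram, List.replicate_succ]⟩

theorem requestMachine_requestProgram (c : ℕ) (l τ : List Bool) :
    requestMachine O E L W (requestProgram c l) = some τ ↔
      (requestStart O E (2 ^ (2 * c + W)) (l.length + 2 * c) ≤ binaryValue l ∧
        binaryValue l < requestStart O E (2 ^ (2 * c + W)) (l.length + 2 * c) +
          (newCells O E (2 ^ (2 * c + W)) (l.length + 2 * c) (l.length + 2 * c)).card) ∧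
      List.replicate (L (l.length + 2 * c)) false ++ true :: requestProgram c l = τ := by
  have hlt : c < (requestProgram c l).length := by
    rw [length_requestProgram]
    omega
  simp only [requestMachine, idxOf_requestProgram, drop_requestProgram, hlt, decide_true,
    Bool.true_and, ← Bool.decide_and, Bool.cond_decide]
  split_ifs with h <;> simp [h]

theorem computable_requestMachine (hO : Computable O) (hE : Computable E) (hL : Computable L) :
    Computable (requestMachine O E L W) := by
  have hc : Computable fun p : List Bool => p.idxOf true :=
    Primrec.list_idxOf.to_comp.comp (.const true) .id
  have hl : Computable fun p : List Bool => p.drop (p.idxOf true + 1) :=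
    Primrec.list_drop.to_comp.comp (.nat_add hc (.const 1)) .id
  have hj : Computable fun p : List Bool =>
      (p.drop (p.idxOf true + 1)).length + 2 * p.idxOf true :=
    .nat_add (Computable.list_length.comp hl) (.nat_mul (.const 2) hc)
  have hN : Computable fun p : List Bool => 2 ^ (2 * p.idxOf true + W) :=
    .two_pow (.nat_add (.nat_mul (.const 2) hc) (.const W))
  have hv := primrec_binaryValue.to_comp.comp hl
  have hs := computable_requestStart hO hE hN hj
  have hrep : Computable fun n : ℕ => List.replicate n false :=
    ((Primrec.list_map Primrec.list_range (Primrec₂.const false)).of_eq fun n => by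
      simp).to_comp
  refine .cond (.and (.decide_lt hc Computable.list_length) (.and (.decide_le hs hv)
    (.decide_lt hv (.nat_add hs (computable_card_newCells hO hE hN hj))))) ?_ (.const none)
  exact Computable.option_some.comp (Computable.list_append.comp (hrep.comp (hL.comp hj))
    (Computable.list_cons.comp (.const true) .id))

theorem isPrefixFreeMachine_requestMachine (hO : Computable O) (hE : Computable E)
    (hL : Computable L) :
    IsPrefixFreeMachine fun p => (requestMachine O E L W p : Part (List Bool)) := by
  refine ⟨(computable_requestMachine hO hE hL).ofOption, fun p q hp hq hpq => ?_⟩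
  rw [Part.ofOption_dom] at hp hq
  have hform {p : List Bool} (hp : (requestMachine O E L W p).isSome) :
      ∃ c l, p = requestProgram c l := by
    refine exists_eq_requestProgram ?_
    by_contra h
    simp [requestMachine, h] at hp
  obtain ⟨c, l, rfl⟩ := hform hp
  obtain ⟨c', l', rfl⟩ := hform hq
  obtain ⟨m, hm⟩ := hpq
  have hprog : requestProgram c l ++ m = requestProgram c (l ++ m) := by simp [requestProgram]
  rw [hprog] at hm
  have hc : c = c' := by rw [← idxOf_requestProgram c (l ++ m), hm, idxOf_requestProgram]
  subst hc
  have hl : l ++ m = l' := by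
    rw [← drop_requestProgram c (l ++ m), hm, drop_requestProgram]
  subst hl
  obtain ⟨τ, hτ⟩ := Option.isSome_iff_exists.1 hp
  obtain ⟨τ', hτ'⟩ := Option.isSome_iff_exists.1 hq
  obtain ⟨⟨-, hlt⟩, -⟩ := (requestMachine_requestProgram _ _ _).1 hτ
  obtain ⟨⟨hle, -⟩, -⟩ := (requestMachine_requestProgram _ _ _).1 hτ'
  rcases Nat.eq_zero_or_pos m.length with hm0 | hmpos
  · rw [List.length_eq_zero_iff.1 hm0, List.append_nil]
  · exfalso
    rw [binaryValue_append, List.length_append] at hle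
    have hstart := requestStart_add_mul_le (O := O) (E := E) (N := 2 ^ (2 * c + W))
      (j := l.length + 2 * c) (j' := l.length + m.length + 2 * c) (by omega)
    have e : l.length + m.length + 2 * c - (l.length + 2 * c) = m.length := by omega
    rw [e] at hstart
    have h1 := binaryValue_lt m
    have h2 := (Nat.mul_le_mul_right (2 ^ m.length) hlt).trans (hstart.trans hle)
    rw [Nat.succ_mul] at h2
    omega

end RequestMachine

/-- A form of Solovay's criterion for the randomness of the halting probability: if the intervals
`[O j / 2 ^ j, E j / 2 ^ j)`, whose left endpoints are the approximations to the halting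
probability, are computable and of finite total length, then only finitely many of them contain
it. -/
theorem IsStaging.finite_setOf_haltingProbability_lt {V : List Bool →. List Bool}
    {f : ℕ → List Bool → Option (List Bool)} (hf : IsStaging V f) (hV : IsUniversalPrefixFree V)
    {E : ℕ → ℕ} (hE : Computable E) {W : ℕ}
    (hW : ∀ J, ∑ j ∈ Finset.range J, ((E j - stageNumerator f j : ℕ) : ℝ) / 2 ^ j ≤ 2 ^ W) :
    {j | haltingProbability V < (E j : ℝ) / 2 ^ j}.Finite := by
  classical
  have hO := hf.monotone_stageNumerator_div
  set O := stageNumerator f with hOdef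
  obtain ⟨c₀, hc₀⟩ := hV.simulates _ (isPrefixFreeMachine_requestMachine (W := W)
    hf.computable_stageNumerator hE hf.computable_outputBound)
  -- With `c` larger than the constant of the simulation, the requests are cheaper by a factor of
  -- `2 ^ c` than what they make `V` spend.
  set c := c₀ + 1 with hc
  set N := 2 ^ (2 * c + W) with hN
  by_contra hinf
  obtain ⟨S, hS, hScard⟩ := (Set.not_finite.1 hinf : Set.Infinite _).exists_subset_card_eq N
  obtain ⟨J, hJ⟩ : ∃ J, ∀ j ∈ S, j ≤ J := ⟨S.sup id, fun j hj => Finset.le_sup (f := id) hj⟩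
  set y := ⌊haltingProbability V * 2 ^ J⌋₊ with hy
  have hy1 : haltingProbability V * 2 ^ J < y + 1 := Nat.lt_floor_add_one _
  have hcover : N ≤ coverCount E J (J + 1) y := by
    rw [← hScard]
    refine Finset.card_le_card fun j hj => Finset.mem_filter.2
      ⟨Finset.mem_range.2 (Nat.lt_succ_of_le (hJ j hj)), ?_⟩
    have hlt : haltingProbability V < (E j : ℝ) / 2 ^ j := hS hj
    rw [hy, Nat.floor_lt' (by
      rintro h0
      have : E j = 0 := by simpa using h0
      rw [this, Nat.cast_zero, zero_div] at hlt
      exact hlt.not_ge (tsum_nonneg fun _ => by positivity))]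
    push_cast
    rw [pow_sub₀ _ two_ne_zero (hJ j hj)]
    calc haltingProbability V * 2 ^ J < E j / 2 ^ j * 2 ^ J := by gcongr
      _ = E j * (2 ^ J * (2 ^ j)⁻¹) := by field_simp
  obtain ⟨t, htJ, ht⟩ := exists_le_sum_card_newCells (O := O) (by positivity) hcover
  -- Each interval counted at an index `j` yields a program of `V` of length at most `j`.
  have hreq : ∀ j k, k < (newCells O E N j j).card → ∃ p q σ : List Bool, σ ∈ V q ∧
      q.length ≤ j ∧ σ = List.replicate (outputBound f j) false ++ true :: p ∧
      ∃ l : List Bool, p = requestProgram c l ∧ l.length + 2 * c = j ∧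
        binaryValue l = requestStart O E N j + k := by
    intro j k hk
    have hbound := mul_requestStart_add_le (N := N) (E := E) hO hW j
    have hcj : 2 * c ≤ j := by
      have : 2 ^ (2 * c + W) ≤ 2 ^ (j + W) :=
        le_trans (Nat.le_mul_of_pos_right _ (by omega)) hbound
      have := (Nat.pow_le_pow_iff_right (by norm_num)).1 this
      omega
    have hz : requestStart O E N j + k < 2 ^ (j - 2 * c) := by
      have e : 2 ^ (j + W) = N * 2 ^ (j - 2 * c) := by
        rw [hN, ← pow_add]
        congr 1
        omega
      rw [e] at hbound
      have := Nat.le_of_mul_le_mul_left hbound (by positivity)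
      omega
    obtain ⟨l, hl, hlz⟩ := exists_binaryValue_eq hz
    have hlj : l.length + 2 * c = j := by omega
    obtain ⟨q, hq, hqlen⟩ := hc₀ (requestProgram c l)
      (List.replicate (outputBound f j) false ++ true :: requestProgram c l)
      (Part.mem_ofOption.2 ((requestMachine_requestProgram _ _ _).2
        (by rw [hlj, ← hN, ← hOdef]; exact ⟨⟨by omega, by omega⟩, rfl⟩)))
    rw [length_requestProgram] at hqlen
    exact ⟨_, q, _, hq, by omega, rfl, l, rfl, hlj, hlz⟩
  choose! p q σ hσ hqlen hσp l hp hlj hlz using hreq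
  set I : Finset ((_ : ℕ) × ℕ) :=
    (Finset.Icc t J).sigma fun j => Finset.range (newCells O E N j j).card with hI
  have hmem {x : (_ : ℕ) × ℕ} (hx : x ∈ I) :
      (t ≤ x.1 ∧ x.1 ≤ J) ∧ x.2 < (newCells O E N x.1 x.1).card := by
    simpa [hI] using hx
  have hinj : Set.InjOn (fun x : (_ : ℕ) × ℕ => q x.1 x.2) I := by
    rintro ⟨j, k⟩ hx ⟨j', k'⟩ hx' heq
    have hk := (hmem hx).2
    have hk' := (hmem hx').2
    dsimp only at hk hk' heq
    have hσeq : σ j k = σ j' k' := Part.mem_unique (hσ j k hk) (heq ▸ hσ j' k' hk')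
    rw [hσp j k hk, hσp j' k' hk'] at hσeq
    -- The output determines the program of the request machine.
    have hidx := congr_arg (List.idxOf true) hσeq
    change List.idxOf true (requestProgram _ _) = List.idxOf true (requestProgram _ _) at hidx
    rw [idxOf_requestProgram, idxOf_requestProgram] at hidx
    rw [hidx] at hσeq
    have hpeq := (List.cons.inj (List.append_cancel_left hσeq)).2
    rw [hp j k hk, hp j' k' hk'] at hpeq
    have hleq : l j k = l j' k' := by
      rw [← drop_requestProgram c (l j k), hpeq, drop_requestProgram]
    have hj : j = j' := by rw [← hlj j k hk, ← hlj j' k' hk', hleq]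
    subst hj
    have := hlz j k hk
    rw [hleq, hlz j k' hk'] at this
    rw [Nat.add_left_cancel this]
  have hgrow := hf.stageNumerator_div_add_sum_le hV.toIsPrefixFreeMachine (t := t)
    (Q := I.image fun x => q x.1 x.2) (by
      intro q' hq'
      obtain ⟨x, hx, rfl⟩ := Finset.mem_image.1 hq'
      obtain ⟨⟨htx, -⟩, hk⟩ := hmem hx
      refine ⟨_, hσ _ _ hk, ?_⟩
      have := hf.monotone_outputBound htx
      rw [hσp _ _ hk, List.length_append, List.length_replicate, List.length_cons]
      omega)
  rw [Finset.sum_image hinj] at hgrow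
  have hsum : ∑ j ∈ Finset.Icc t J, ((newCells O E N j j).card : ℝ) / 2 ^ j ≤
      ∑ x ∈ I, (2⁻¹ : ℝ) ^ (q x.1 x.2).length := by
    rw [hI, Finset.sum_sigma]
    refine Finset.sum_le_sum fun j _ => ?_
    rw [div_eq_mul_inv, ← nsmul_eq_mul, ← Finset.card_range (newCells O E N j j).card,
      Finset.card_range]
    refine le_trans (le_of_eq ?_) (Finset.card_nsmul_le_sum _ _ ((2 ^ j)⁻¹ : ℝ) fun k hk => ?_)
    · rw [Finset.card_range]
    · rw [← inv_pow]
      exact pow_le_pow_of_le_one (by norm_num) (by norm_num) (hqlen j k (Finset.mem_range.1 hk))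
  have hfill : ((y : ℝ) + 1) / 2 ^ J ≤
      O t / 2 ^ t + ∑ j ∈ Finset.Icc t J, ((newCells O E N j j).card : ℝ) / 2 ^ j := by
    have e {a : ℝ} {k : ℕ} (hk : k ≤ J) : a * 2 ^ (J - k) / 2 ^ J = a / 2 ^ k := by
      rw [pow_sub₀ _ two_ne_zero hk]
      field_simp
    have : (y : ℝ) + 1 ≤ O t * 2 ^ (J - t) +
        ∑ j ∈ Finset.Icc t J, ((newCells O E N j j).card : ℝ) * 2 ^ (J - j) := by
      rw [Finset.sum_congr rfl fun j hj => card_newCells (Finset.mem_Icc.1 hj).2] at ht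
      exact_mod_cast ht
    refine (div_le_div_of_nonneg_right this (by positivity)).trans (le_of_eq ?_)
    rw [add_div, e htJ, Finset.sum_div]
    congr 1
    exact Finset.sum_congr rfl fun j hj => e (Finset.mem_Icc.1 hj).2
  have hlt : haltingProbability V < ((y : ℝ) + 1) / 2 ^ J := by
    rwa [lt_div_iff₀ (by positivity)]
  linarith

/-! ### Events that change at most twice -/

section Changes

variable {V : List Bool →. List Bool} {f : ℕ → List Bool → Option (List Bool)}

/-- If the computable events `D t n` form, for each `n`, an interval of stages `t`, so that they
change at most twice, and the weights `2 ^ (-m n)` are summable, then at each change, with finitely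
many exceptions `n`, the halting probability exceeds its current approximation by `2 ^ (-m n)`. -/
theorem IsStaging.finite_setOf_change (hf : IsStaging V f) (hV : IsUniversalPrefixFree V)
    {D : ℕ → ℕ → Bool} (hD : Computable₂ D)
    (hconv : ∀ {n s r t}, s ≤ r → r ≤ t → D s n = true → D t n = true → D r n = true)
    {m : ℕ → ℕ} (hm : Computable m) (hmn : ∀ n, m n ≤ n) {W : ℕ}
    (hW : ∀ A : Finset ℕ, (∀ n ∈ A, ∃ t, D t n = true) →
      ∑ n ∈ A, (2⁻¹ : ℝ) ^ m n ≤ 2 ^ W) :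
    {n | ∃ t, D (t + 1) n ≠ D t n ∧ haltingProbability V <
      (stageNumerator f (t + 1) : ℝ) / 2 ^ (t + 1) + 2⁻¹ ^ m n}.Finite := by
  classical
  set O := stageNumerator f with hOdef
  have hO : Monotone fun j => (O j : ℝ) / 2 ^ j := hf.monotone_stageNumerator_div
  -- The index `j` stands for the pair of the stage `T j` and the event number `n j`.
  set T : ℕ → ℕ := fun j => j.unpair.1 with hT
  set n : ℕ → ℕ := fun j => j.unpair.2 with hn
  have hTj (j : ℕ) : T j ≤ j := Nat.unpair_left_le j
  have hmj (j : ℕ) : m (n j) ≤ j := (hmn _).trans (Nat.unpair_right_le j)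
  set E : ℕ → ℕ := fun j => bif D (T j) (n j) ^^ D (T j - 1) (n j) then
    O (T j) * 2 ^ (j - T j) + 2 ^ (j - m (n j)) else 0 with hEdef
  have hE : Computable E := by
    have hTc : Computable T := Computable.fst.comp .unpair
    have hnc : Computable n := Computable.snd.comp .unpair
    have hxor : Computable₂ xor := (Primrec.dom_bool₂ xor).to_comp
    refine .cond (hxor.comp (hD.comp hTc hnc) (hD.comp (.nat_sub hTc (.const 1)) hnc)) ?_
      (.const 0)
    exact .nat_add (.nat_mul (hf.computable_stageNumerator.comp hTc) (.two_pow (.nat_sub .id hTc)))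
      (.two_pow (.nat_sub .id (hm.comp hnc)))
  have hEval {j : ℕ} (h : D (T j) (n j) ≠ D (T j - 1) (n j)) :
      (E j : ℝ) / 2 ^ j = O (T j) / 2 ^ T j + 2⁻¹ ^ m (n j) := by
    have hx : (D (T j) (n j) ^^ D (T j - 1) (n j)) = true := by simpa using h
    simp only [hEdef, hx, cond_true]
    push_cast
    rw [pow_sub₀ _ two_ne_zero (hTj j), pow_sub₀ _ two_ne_zero (hmj j), inv_pow]
    field_simp
  have hfin := hf.finite_setOf_haltingProbability_lt hV hE (W := W + 1) ?_
  · refine (hfin.image n).subset ?_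
    rintro k ⟨t, hne, hlt⟩
    have hTk : T (Nat.pair (t + 1) k) = t + 1 := by simp [hT]
    have hnk : n (Nat.pair (t + 1) k) = k := by simp [hn]
    refine ⟨Nat.pair (t + 1) k, ?_, hnk⟩
    change haltingProbability V < (E (Nat.pair (t + 1) k) : ℝ) / 2 ^ Nat.pair (t + 1) k
    rw [hEval (by rw [hTk, hnk]; exact hne), hTk, hnk]
    exact hlt
  · intro J
    have hterm (j : ℕ) : ((E j - O j : ℕ) : ℝ) / 2 ^ j ≤
        (if D (T j) (n j) = true ∧ D (T j - 1) (n j) = false then 2⁻¹ ^ m (n j) else 0) +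
        (if D (T j) (n j) = false ∧ D (T j - 1) (n j) = true then 2⁻¹ ^ m (n j) else 0) := by
      by_cases h : D (T j) (n j) = D (T j - 1) (n j)
      · have : E j = 0 := by simp [hEdef, h]
        rw [this, Nat.zero_sub, Nat.cast_zero, zero_div]
        positivity
      · have hle : ((E j - O j : ℕ) : ℝ) / 2 ^ j ≤ 2⁻¹ ^ m (n j) := by
          rcases le_total (E j) (O j) with h' | h'
          · rw [Nat.sub_eq_zero_of_le h', Nat.cast_zero, zero_div]
            positivity
          · rw [Nat.cast_sub h', sub_div, hEval h]
            have : (O (T j) : ℝ) / 2 ^ T j ≤ O j / 2 ^ j := hO (hTj j)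
            linarith
        cases h1 : D (T j) (n j) <;> cases h2 : D (T j - 1) (n j) <;> simp_all
    have hpart (P : ℕ → Prop) [DecidablePred P] (hact : ∀ j, P j → ∃ t, D t (n j) = true)
        (hinj : ∀ j j', P j → P j' → n j = n j' → ¬T j < T j') :
        ∑ j ∈ Finset.range J, (if P j then (2⁻¹ : ℝ) ^ m (n j) else 0) ≤ 2 ^ W := by
      rw [← Finset.sum_filter, ← Finset.sum_image (f := fun k => (2⁻¹ : ℝ) ^ m k)]
      · refine hW _ fun k hk => ?_
        obtain ⟨j, hj, rfl⟩ := Finset.mem_image.1 hk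
        exact hact j (Finset.mem_filter.1 hj).2
      · intro j hj j' hj' hne
        have hj := (Finset.mem_filter.1 hj).2
        have hj' := (Finset.mem_filter.1 hj').2
        have hTT : T j = T j' :=
          le_antisymm (not_lt.1 (hinj j' j hj' hj hne.symm)) (not_lt.1 (hinj j j' hj hj' hne))
        rw [← Nat.pair_unpair j, ← Nat.pair_unpair j']
        exact congr_arg₂ Nat.pair hTT hne
    refine (Finset.sum_le_sum fun j _ => hterm j).trans ?_
    rw [Finset.sum_add_distrib, pow_succ, mul_two]
    refine add_le_add
      (hpart (fun j => D (T j) (n j) = true ∧ D (T j - 1) (n j) = false)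
        (fun j h => ⟨_, h.1⟩) fun j j' h h' hnn hlt => ?_)
      (hpart (fun j => D (T j) (n j) = false ∧ D (T j - 1) (n j) = true)
        (fun j h => ⟨_, h.2⟩) fun j j' h h' hnn hlt => ?_)
    · have := hconv (by omega : T j ≤ T j' - 1) (Nat.sub_le _ _) (hnn ▸ h.1) h'.1
      rw [h'.2] at this
      cases this
    · have := hconv (Nat.sub_le _ _) (by omega : T j ≤ T j' - 1) (hnn ▸ h.2) h'.2
      rw [← hnn, h.1] at this
      cases this

/-- The halting probability is not a dyadic rational `d`: otherwise, it would not exceed by `2⁻ⁿ`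
its first approximation above `d - 2⁻ⁿ`. -/
theorem IsUniversalPrefixFree.haltingProbability_ne_div (hV : IsUniversalPrefixFree V) (a k : ℕ) :
    haltingProbability V ≠ (a : ℝ) / 2 ^ k := by
  intro heq
  obtain ⟨f, hf⟩ := exists_isStaging hV.partrec
  have hO := hf.monotone_stageNumerator_div
  set O := stageNumerator f with hOdef
  -- Requiring `1 ≤ t` makes sure that the event begins with a change.
  set D : ℕ → ℕ → Bool := fun t n =>
    decide (1 ≤ t) && decide (a * 2 ^ (t + n) < (O t * 2 ^ n + 2 ^ t) * 2 ^ k) with hDdef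
  have hD {t n : ℕ} : D t n = true ↔ 1 ≤ t ∧ (a : ℝ) / 2 ^ k < O t / 2 ^ t + 2⁻¹ ^ n := by
    have e : (O t : ℝ) / 2 ^ t + 2⁻¹ ^ n = ((O t * 2 ^ n + 2 ^ t : ℕ) : ℝ) / 2 ^ (t + n) := by
      push_cast
      rw [pow_add, inv_pow]
      field_simp
    rw [hDdef, Bool.and_eq_true, decide_eq_true_iff, decide_eq_true_iff, e,
      div_lt_div_iff₀ (by positivity) (by positivity)]
    norm_cast
  have hmono {s t n : ℕ} (hst : s ≤ t) (h : D s n = true) : D t n = true := by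
    rw [hD] at h ⊢
    have : (O s : ℝ) / 2 ^ s ≤ O t / 2 ^ t := hO hst
    exact ⟨h.1.trans hst, by linarith⟩
  have hDc : Computable₂ D :=
    .and (.decide_le (.const 1) .fst) (.decide_lt
      (.nat_mul (.const a) (.two_pow (.nat_add .fst .snd)))
      (.nat_mul (.nat_add (.nat_mul (hf.computable_stageNumerator.comp .fst) (.two_pow .snd))
        (.two_pow .fst)) (.const _)))
  have hfin := hf.finite_setOf_change hV hDc (fun hsr _ h _ => hmono hsr h) (m := id) .id
    (fun _ => le_rfl) (W := 1) (fun A _ => by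
      have h := (summable_geometric_two).sum_le_tsum A (fun _ _ => by positivity)
      rw [tsum_geometric_two] at h
      simpa using h)
  refine Set.infinite_univ (hfin.subset fun n _ => ?_)
  have hex : ∃ t, D t n = true := by
    have hpos : (0 : ℝ) < 2⁻¹ ^ n := by positivity
    obtain ⟨t, ht⟩ := hf.exists_lt_stageNumerator_div hV.toIsPrefixFreeMachine
      (sub_lt_self (haltingProbability V) hpos)
    have : (O t : ℝ) / 2 ^ t ≤ O (t + 1) / 2 ^ (t + 1) := hO t.le_succ
    rw [← hOdef] at ht
    exact ⟨t + 1, hD.2 ⟨by omega, by rw [← heq]; linarith⟩⟩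
  have hspec := Nat.find_spec hex
  obtain ⟨t, ht⟩ := Nat.exists_eq_add_of_le' (hD.1 hspec).1
  have hmin := Nat.find_min hex (m := t) (by omega)
  rw [ht] at hspec
  refine ⟨t, by rw [hspec]; exact fun h => hmin h.symm, ?_⟩
  rw [heq]
  exact (hD.1 hspec).2

end Changes

/-! ### Oracle programs -/

namespace OracleCode

/-- A program without queries, as an oracle program. -/
def ofCode : Nat.Partrec.Code → OracleCode
  | .zero => .zero
  | .succ => .succ
  | .left => .left
  | .right => .right
  | .pair c d => .pair (ofCode c) (ofCode d)
  | .comp c d => .comp (ofCode c) (ofCode d)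
  | .prec c d => .prec (ofCode c) (ofCode d)
  | .rfind' c => .rfind' (ofCode c)

variable {Y : ℕ → Bool}

theorem halts_ofCode {c : Nat.Partrec.Code} {x r : ℕ} (h : r ∈ c.eval x) :
    Halts Y (ofCode c) x r 0 := by
  induction c generalizing x r with
  | zero =>
    obtain rfl : r = 0 := by simpa [Nat.Partrec.Code.eval, pure, PFun.pure] using h
    exact .zero x
  | succ =>
    obtain rfl : r = x + 1 := by simpa [Nat.Partrec.Code.eval] using h
    exact .succ x
  | left =>
    obtain rfl : r = x.unpair.1 := by simpa [Nat.Partrec.Code.eval] using h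
    exact .left x
  | right =>
    obtain rfl : r = x.unpair.2 := by simpa [Nat.Partrec.Code.eval] using h
    exact .right x
  | pair c d ihc ihd =>
    simp only [Nat.Partrec.Code.eval, Seq.seq, Part.map_eq_map, Part.bind_map, Part.mem_bind_iff,
      Part.mem_map_iff] at h
    obtain ⟨a, ha, b, hb, rfl⟩ := h
    exact .pair (ihc ha) (ihd hb)
  | comp c d ihc ihd =>
    simp only [Nat.Partrec.Code.eval] at h
    obtain ⟨y, hy, hr⟩ := Part.mem_bind_iff.1 h
    exact .comp (ihd hy) (ihc hr)
  | prec c d ihc ihd =>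
    rw [← Nat.pair_unpair x] at h ⊢
    generalize x.unpair.1 = a at h ⊢
    generalize x.unpair.2 = k at h ⊢
    induction k generalizing r with
    | zero =>
      rw [Nat.Partrec.Code.eval_prec_zero] at h
      exact .prec_zero (ihc h)
    | succ k ih =>
      rw [Nat.Partrec.Code.eval_prec_succ] at h
      obtain ⟨y, hy, hr⟩ := Part.mem_bind_iff.1 h
      exact .prec_succ (ih hy) (ihd hr)
  | rfind' c ih =>
    rw [← Nat.pair_unpair x] at h ⊢
    generalize x.unpair.1 = a at h ⊢
    generalize x.unpair.2 = m at h ⊢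
    simp only [Nat.Partrec.Code.eval, Nat.unpaired, Nat.unpair_pair, Part.mem_map_iff] at h
    obtain ⟨k, hk, rfl⟩ := h
    obtain ⟨hk0, hlt⟩ := Nat.mem_rfind.1 hk
    induction k generalizing m with
    | zero =>
      obtain ⟨y, hy, hy0⟩ := (Part.mem_map_iff _).1 hk0
      obtain rfl : y = 0 := by simpa using hy0
      rw [Nat.zero_add] at hy ⊢
      exact .rfind_found (ih hy)
    | succ k ihk =>
      obtain ⟨y, hy, hy0⟩ := (Part.mem_map_iff _).1 (hlt (Nat.succ_pos k))
      obtain ⟨y, rfl⟩ := Nat.exists_eq_succ_of_ne_zero (n := y) (by simpa using hy0)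
      rw [Nat.zero_add] at hy
      have e (i : ℕ) : i + (m + 1) = i + 1 + m := by omega
      have := ihk (m + 1) (Nat.mem_rfind.2 ⟨by rwa [e], fun {i} hi => by
        rw [e]; exact hlt (Nat.succ_lt_succ hi)⟩) (by rwa [e]) fun {i} hi => by
          rw [e]; exact hlt (Nat.succ_lt_succ hi)
      rw [e] at this
      exact .rfind_next (ih hy) this

/-- Partial recursive functions are computed by oracle programs without queries. -/
theorem exists_halts_of_partrec {h : ℕ →. ℕ} (hh : Nat.Partrec h) :
    ∃ c : OracleCode, ∀ {Y : ℕ → Bool} {x r : ℕ}, r ∈ h x → Halts Y c x r 0 := by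
  obtain ⟨c, rfl⟩ := Nat.Partrec.Code.exists_code.1 hh
  exact ⟨ofCode c, halts_ofCode⟩

/-- One program computes, from the pair of `a` and `u`, the first `u` bits of the oracle, and
queries exactly those. -/
theorem exists_halts_initialSegment : ∃ c : OracleCode, ∀ (Y : ℕ → Bool) (a u : ℕ),
    Halts Y c (Nat.pair a u) (encode (initialSegment Y u)) u := by
  have happ : Computable fun z : ℕ =>
      encode (((decode (α := List Bool) z.unpair.1).getD []) ++ [decide (z.unpair.2 = 1)]) := by
    refine Computable.encode.comp (Computable.list_concat.comp ?_ ?_)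
    · exact .option_getD (Computable.decode.comp (Computable.fst.comp .unpair)) (.const [])
    · exact .decide_eq (Computable.snd.comp .unpair) (.const 1)
  obtain ⟨c, hc⟩ := exists_halts_of_partrec (Partrec.nat_iff.1 happ.partrec)
  -- The recursion starts with `0`, which is the code of the empty string.
  refine ⟨.prec .zero (.comp c (.pair (.comp .right .right) (.comp .query (.comp .left .right)))),
    fun Y a u => ?_⟩
  induction u with
  | zero => exact .prec_zero (.zero a)
  | succ k ih =>
    set w := encode (initialSegment Y k) with hw
    have h1 : Halts Y .right (Nat.pair a (Nat.pair k w)) (Nat.pair k w) 0 := by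
      simpa using Halts.right (Y := Y) (Nat.pair a (Nat.pair k w))
    have h2 : Halts Y .right (Nat.pair k w) w 0 := by
      simpa using Halts.right (Y := Y) (Nat.pair k w)
    have h3 : Halts Y .left (Nat.pair k w) k 0 := by
      simpa using Halts.left (Y := Y) (Nat.pair k w)
    have h4 := Halts.pair (.comp h1 h2) (.comp (.comp h1 h3) (.query k))
    have h5 : encode (initialSegment Y (k + 1)) ∈ (Part.some (encode
        (((decode (α := List Bool) (Nat.pair w (Y k).toNat).unpair.1).getD []) ++
          [decide ((Nat.pair w (Y k).toNat).unpair.2 = 1)])) : Part ℕ) := by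
      rw [Part.mem_some_iff, Nat.unpair_pair, hw, encodek, Option.getD_some, initialSegment_succ]
      cases Y k <;> rfl
    have h6 := Halts.prec_succ ih (.comp h4 (hc h5))
    simpa using h6

theorem halts_id (x : ℕ) : Halts Y (.pair .left .right) x x 0 := by
  simpa using Halts.pair (Y := Y) (.left x) (.right x)

end OracleCode

/-- To compute the first `n` bits of `X` from `Y` with use `g n`, it suffices to recognize, from the
first `u` bits of `Y` for `u ≤ g n`, whether `u = g n`, and to compute the first `n` bits of `X`
from the first `g n` bits of `Y`: the bits of `Y` are queried one by one. -/
theorem computableWithUse_of_partrec {X Y : ℕ → Bool} {T : ℕ → List Bool →. Option (List Bool)}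
    (hT : Partrec₂ T) {g : ℕ → ℕ} (hlt : ∀ n u, u < g n → none ∈ T n (initialSegment Y u))
    (heq : ∀ n, some (initialSegment X n) ∈ T n (initialSegment Y (g n))) :
    ComputableWithUse X Y fun n => g n := by
  have hT' : Partrec fun z : ℕ => T z.unpair.1 ((decode (α := List Bool) z.unpair.2).getD []) :=
    hT.comp (Computable.fst.comp .unpair)
      (.option_getD (Computable.decode.comp (Computable.snd.comp .unpair)) (.const []))
  have hpair (n u : ℕ) : T (Nat.pair n (encode (initialSegment Y u))).unpair.1
      ((decode (α := List Bool) (Nat.pair n (encode (initialSegment Y u))).unpair.2).getD []) =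
      T n (initialSegment Y u) := by
    simp
  obtain ⟨flag, hflag⟩ := OracleCode.exists_halts_of_partrec (Partrec.nat_iff.1
    (hT'.map (g := fun _ o => (!o.isSome).toNat)
      (Computable.bool_toNat (Primrec.not.to_comp.comp (.option_isSome .snd))).to₂))
  obtain ⟨out, hout⟩ := OracleCode.exists_halts_of_partrec (Partrec.nat_iff.1
    (hT'.map (g := fun _ o => encode (o.getD []))
      (Computable.encode.comp (.option_getD .snd (.const []))).to₂))
  obtain ⟨bits, hbits⟩ := OracleCode.exists_halts_initialSegment
  have hread (n u : ℕ) : OracleCode.Halts Y (.pair .left bits) (Nat.pair n u)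
      (Nat.pair n (encode (initialSegment Y u))) u := by
    simpa using OracleCode.Halts.pair (.left _) (hbits Y n u)
  have htest_lt (n u : ℕ) (h : u < g n) :
      OracleCode.Halts Y (.comp flag (.pair .left bits)) (Nat.pair n u) (0 + 1) u := by
    have := OracleCode.Halts.comp (hread n u) (hflag (Y := Y)
      (Part.mem_map _ (by rw [hpair]; exact hlt n u h)))
    simpa using this
  have htest_eq (n : ℕ) :
      OracleCode.Halts Y (.comp flag (.pair .left bits)) (Nat.pair n (g n)) 0 (g n) := by
    have := OracleCode.Halts.comp (hread n (g n)) (hflag (Y := Y)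
      (Part.mem_map _ (by rw [hpair]; exact heq n)))
    simpa using this
  have hsearch (n d : ℕ) : ∀ k, k + d = g n → OracleCode.Halts Y
      (.rfind' (.comp flag (.pair .left bits))) (Nat.pair n k) (g n) (g n) := by
    induction d with
    | zero =>
      rintro k rfl
      exact .rfind_found (htest_eq n)
    | succ d ih =>
      intro k hk
      have := OracleCode.Halts.rfind_next (htest_lt n k (by omega)) (ih (k + 1) (by omega))
      rwa [max_eq_right (by omega)] at this
  refine ⟨.comp (.comp out (.pair .left bits)) (.pair (.pair .left .right)
    (.comp (.rfind' (.comp flag (.pair .left bits))) (.pair (.pair .left .right) .zero))),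
    fun n => ⟨g n, rfl, ?_⟩⟩
  have h1 := OracleCode.Halts.comp (.pair (OracleCode.halts_id n) (.zero n))
    (hsearch n (g n) 0 (Nat.zero_add _))
  have h2 := OracleCode.Halts.comp (hread n (g n)) (hout (Y := Y)
    (Part.mem_map _ (by rw [hpair]; exact heq n)))
  simpa using OracleCode.Halts.comp (.pair (OracleCode.halts_id n) h1) h2

/-! ### Recognizing the prefixes of a left-c.e. real in the limit -/

theorem Primrec.int_toNat : Primrec Int.toNat := by
  refine (Primrec.ite (c := fun z : ℤ => encode z % 2 = 0) (f := fun z => encode z / 2)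
    (g := fun _ => 0) ?_ ?_ (.const 0)).of_eq fun z => ?_
  · exact Primrec.eq.comp (Primrec.nat_mod.comp .encode (.const 2)) (.const 0)
  · exact Primrec.nat_div.comp .encode (.const 2)
  · have hpos (k : ℕ) : encode (Int.ofNat k) = 2 * k := rfl
    have hneg (k : ℕ) : encode (Int.negSucc k) = 2 * k + 1 := rfl
    cases z with
    | ofNat k =>
      rw [hpos, if_pos (by omega)]
      change 2 * k / 2 = k
      omega
    | negSucc k =>
      rw [hneg, if_neg (by omega)]
      rfl

theorem eventually_const_of_streamValue_mul_eq {X : ℕ → Bool} {N z : ℕ}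
    (h : streamValue X * 2 ^ N = z) : ∃ b, ∀ i, N ≤ i → X i = b := by
  have hv (d : ℕ) : binaryValue (initialSegment X (N + d)) ≤ z * 2 ^ d ∧
      z * 2 ^ d ≤ binaryValue (initialSegment X (N + d)) + 1 := by
    have := binaryValue_initialSegment_le X (N + d)
    rw [pow_add, ← mul_assoc, h] at this
    exact_mod_cast this
  have hstep (d : ℕ) : binaryValue (initialSegment X (N + (d + 1))) =
      2 * binaryValue (initialSegment X (N + d)) + (X (N + d)).toNat := by
    rw [← add_assoc, initialSegment_succ, binaryValue_concat]
  have hbit (d : ℕ) := (X (N + d)).toNat_le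
  have hz (d : ℕ) : z * 2 ^ (d + 1) = 2 * (z * 2 ^ d) := by ring
  have hpow (d : ℕ) := hv (d + 1)
  simp only [hstep, hz] at hpow
  -- The bits from `N` on are `0` if the first `N` bits have the value `z`, and else they are `1`.
  by_cases h0 : binaryValue (initialSegment X N) = z
  · have hall (d : ℕ) : binaryValue (initialSegment X (N + d)) = z * 2 ^ d := by
      induction d with
      | zero => simpa using h0
      | succ d ih =>
        have := hpow d
        rw [hstep, hz]
        omega
    refine ⟨false, fun i hi => ?_⟩
    obtain ⟨d, rfl⟩ := Nat.exists_eq_add_of_le hi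
    have h1 := hpow d
    have h2 := hall d
    cases hX : X (N + d) with
    | false => rfl
    | true =>
      rw [hX, Bool.toNat_true] at h1
      omega
  · have hall (d : ℕ) : binaryValue (initialSegment X (N + d)) + 1 = z * 2 ^ d := by
      induction d with
      | zero =>
        have := hv 0
        simp only [pow_zero, mul_one, add_zero] at this ⊢
        omega
      | succ d ih =>
        have h1 := hpow d
        have h2 := hbit d
        rw [hstep, hz]
        omega
    refine ⟨true, fun i hi => ?_⟩
    obtain ⟨d, rfl⟩ := Nat.exists_eq_add_of_le hi
    have h1 := hpow d
    have h2 := hall d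
    cases hX : X (N + d) with
    | true => rfl
    | false =>
      rw [hX, Bool.toNat_false] at h1
      omega

/-- The prefixes of a stream with left-c.e. value can be recognized in the limit in such a way that
a string, once it has been taken for a prefix and is then given up, is never taken for a prefix
again. Streams with a dyadic value, which need not be the limits of the binary expansions
of approximations to the value, are eventually constant. -/
theorem exists_computable_prefix_test {X : ℕ → Bool} (hX : IsLeftCE (streamValue X)) :
    ∃ B : ℕ → List Bool → Bool, Computable₂ B ∧
      (∀ {σ s r t}, s ≤ r → r ≤ t → B s σ = true → B t σ = true → B r σ = true) ∧
      ∀ σ, ∀ᶠ t in Filter.atTop, (B t σ = true ↔ σ = initialSegment X σ.length) := by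
  by_cases hdy : ∃ N z : ℕ, streamValue X * 2 ^ N = z
  · obtain ⟨N, z, h⟩ := hdy
    obtain ⟨b, hb⟩ := eventually_const_of_streamValue_mul_eq h
    have hXp : Primrec X := by
      refine ((Primrec.list_getD b).comp (.const (initialSegment X N)) .id).of_eq fun i => ?_
      rw [id, List.getD_eq_getElem?_getD, initialSegment, List.getElem?_map]
      rcases lt_or_ge i N with hi | hi
      · simp [hi]
      · simp [hi, hb i hi]
    refine ⟨fun _ σ => decide (σ = initialSegment X σ.length), ?_, fun _ _ h _ => h, fun σ => ?_⟩
    · refine .decide_eq .snd (Primrec.to_comp ?_)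
      exact Primrec.list_map (Primrec.list_range.comp (Primrec.list_length.comp .snd))
        (hXp.comp .snd).to₂
    · simp
  · obtain ⟨a, e, ha, he, hmono, hlim⟩ := hX
    set x : ℕ → ℝ := fun t => ((a t).toNat : ℝ) / 2 ^ e t with hx
    have hxmax : x = fun t => max ((a t : ℝ) / 2 ^ e t) 0 := by
      funext t
      have : ((a t).toNat : ℝ) = max (a t : ℝ) 0 := by
        exact_mod_cast congr_arg (Int.cast : ℤ → ℝ) (Int.toNat_eq_max (a t))
      rw [hx]
      dsimp only
      rw [this, ← max_div_div_right (by positivity), zero_div]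
    have hxmono : Monotone x := by
      rw [hxmax]
      exact fun s t hst => max_le_max_right 0 (hmono hst)
    have hxlim : Filter.Tendsto x Filter.atTop (nhds (streamValue X)) := by
      rw [hxmax]
      have := hlim.max (tendsto_const_nhds (x := (0 : ℝ)))
      rwa [max_eq_left (show 0 ≤ streamValue X from Real.ofDigits_nonneg _)] at this
    set B : ℕ → List Bool → Bool := fun t σ =>
      decide (binaryValue σ * 2 ^ e t ≤ (a t).toNat * 2 ^ σ.length) &&
        decide ((a t).toNat * 2 ^ σ.length < (binaryValue σ + 1) * 2 ^ e t) with hBdef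
    have hB {t : ℕ} {σ : List Bool} : B t σ = true ↔
        (binaryValue σ : ℝ) ≤ x t * 2 ^ σ.length ∧
          x t * 2 ^ σ.length < (binaryValue σ : ℝ) + 1 := by
      rw [hBdef, Bool.and_eq_true, decide_eq_true_iff, decide_eq_true_iff, hx,
        div_mul_eq_mul_div, le_div_iff₀ (by positivity), div_lt_iff₀ (by positivity)]
      norm_cast
    refine ⟨B, ?_, ?_, fun σ => ?_⟩
    · have hv : Computable fun q : ℕ × List Bool => binaryValue q.2 :=
        primrec_binaryValue.to_comp.comp .snd
      have hp : Computable fun q : ℕ × List Bool => 2 ^ e q.1 := .two_pow (he.comp .fst)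
      have hm : Computable fun q : ℕ × List Bool => (a q.1).toNat * 2 ^ q.2.length :=
        .nat_mul (Primrec.int_toNat.to_comp.comp (ha.comp .fst))
          (.two_pow (Computable.list_length.comp .snd))
      exact .and (.decide_le (.nat_mul hv hp) hm)
        (.decide_lt hm (.nat_mul (.nat_add hv (.const 1)) hp))
    · intro σ s r t hsr hrt hs ht
      rw [hB] at hs ht ⊢
      have h1 : x s * 2 ^ σ.length ≤ x r * 2 ^ σ.length :=
        mul_le_mul_of_nonneg_right (hxmono hsr) (by positivity)
      have h2 : x r * 2 ^ σ.length ≤ x t * 2 ^ σ.length :=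
        mul_le_mul_of_nonneg_right (hxmono hrt) (by positivity)
      exact ⟨hs.1.trans h1, h2.trans_lt ht.2⟩
    · set n := σ.length with hn
      set v := binaryValue (initialSegment X n) with hv
      obtain ⟨h1, h2⟩ := binaryValue_initialSegment_le X n
      have hlim' : Filter.Tendsto (fun t => x t * 2 ^ n) Filter.atTop
          (nhds (streamValue X * 2 ^ n)) := hxlim.mul_const _
      have h1' : (v : ℝ) < streamValue X * 2 ^ n :=
        lt_of_le_of_ne h1 fun h => hdy ⟨n, v, h.symm⟩
      have h2' : streamValue X * 2 ^ n < v + 1 :=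
        lt_of_le_of_ne h2 fun h => hdy ⟨n, v + 1, by rw [h]; push_cast; rfl⟩
      filter_upwards [hlim'.eventually_const_lt h1', hlim'.eventually_lt_const h2'] with t ht1 ht2
      rw [hB, ← hn]
      constructor
      · rintro ⟨h3, h4⟩
        refine binaryValue_injective (by simp [hn]) (le_antisymm ?_ ?_)
        · have : (binaryValue σ : ℝ) < v + 1 := h3.trans_lt ht2
          exact Nat.lt_succ_iff.1 (by exact_mod_cast this)
        · have : (v : ℝ) < binaryValue σ + 1 := ht1.trans h4
          exact Nat.lt_succ_iff.1 (by exact_mod_cast this)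
      · intro hσ
        have : binaryValue σ = v := by rw [hσ]
        rw [this]
        exact ⟨ht1.le, ht2⟩

/-! ### The computation from the halting probability -/

theorem exists_computable_search {α β : Type*} [Primcodable α] [Primcodable β]
    {g : α → ℕ → Option β} (hg : Computable₂ g) {h : α → ℕ} (hh : Computable h) :
    ∃ F : α → Option β, Computable F ∧ (∀ a x, F a = some x → ∃ k < h a, g a k = some x) ∧
      ∀ a, F a = none → ∀ k < h a, g a k = none := by
  set F : α → ℕ → Option β := fun a t => Nat.rec none (fun k acc => (g a k).or acc) t with hF
  have hsucc (a : α) (t : ℕ) : F a (t + 1) = (g a t).or (F a t) := rfl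
  have hor : Computable₂ (Option.or : Option β → Option β → Option β) :=
    (Primrec.option_orElse.of_eq fun a b => by cases a <;> rfl).to_comp
  refine ⟨fun a => F a (h a), ?_, fun a x => ?_, fun a => ?_⟩
  · exact Computable.nat_rec (h := fun a p => (g a p.1).or p.2) hh (.const none)
      (hor.comp (hg.comp .fst (.comp .fst .snd)) (.comp .snd .snd))
  · dsimp only
    induction h a with
    | zero => intro h; cases h
    | succ t ih =>
      intro hx
      rw [hsucc, Option.or_eq_some_iff] at hx
      rcases hx with hx | ⟨-, hx⟩
      · exact ⟨t, t.lt_succ_self, hx⟩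
      · obtain ⟨k, hk, hkx⟩ := ih hx
        exact ⟨k, hk.trans t.lt_succ_self, hkx⟩
  · dsimp only
    induction h a with
    | zero => intro _ k hk; omega
    | succ t ih =>
      intro hx k hk
      rw [hsucc, Option.or_eq_none_iff] at hx
      rcases Nat.lt_succ_iff_lt_or_eq.1 hk with hk | rfl
      · exact ih hx.2 k hk
      · exact hx.1

theorem IsUniversalPrefixFree.exists_mem {U : List Bool →. List Bool}
    (hU : IsUniversalPrefixFree U) (σ : List Bool) : ∃ p, σ ∈ U p := by
  have hM : IsPrefixFreeMachine fun p =>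
      ((bif decide (p = []) then some σ else none : Option (List Bool)) : Part (List Bool)) := by
    refine ⟨(Computable.cond (.decide_eq .id (.const [])) (.const _) (.const _)).ofOption, ?_⟩
    intro p q hp hq _
    have h {p : List Bool} (hp : ((bif decide (p = []) then some σ else none :
        Option (List Bool)) : Part (List Bool)).Dom) : p = [] := by
      by_contra h
      simp [h] at hp
    rw [h hp, h hq]
  obtain ⟨c, hc⟩ := hU.simulates _ hM
  obtain ⟨q, hq, -⟩ := hc [] σ (by simp)
  exact ⟨q, hq⟩

section Decoding

variable {U V : List Bool →. List Bool} {fU fV : ℕ → List Bool → Option (List Bool)}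
  {X : ℕ → Bool} {B : ℕ → List Bool → Bool}

/-- At all late stages at which the first `u` bits of the halting probability of `V` are right, it
is known which programs of `U` of length at most `u` output a prefix of `X`. -/
theorem exists_forall_prefix_test_correct (hU : IsPrefixFreeMachine U)
    (hV : IsUniversalPrefixFree V) (hfU : IsStaging U fU) (hfV : IsStaging V fV)
    (hB : Computable₂ B)
    (hBconv : ∀ {σ s r t}, s ≤ r → r ≤ t → B s σ = true → B t σ = true → B r σ = true)
    (hBlim : ∀ σ, ∀ᶠ t in Filter.atTop, (B t σ = true ↔ σ = initialSegment X σ.length)) :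
    ∃ s₀, ∀ s, s₀ ≤ s → ∀ u,
      stageNumerator fV s * 2 ^ u / 2 ^ s = ⌊haltingProbability V * 2 ^ u⌋₊ →
      ∀ p : List Bool, p.length ≤ u →
        ((∃ σ, fU s p = some σ ∧ B s σ = true) ↔ ∃ i, initialSegment X i ∈ U p) := by
  classical
  have hO := hfV.monotone_stageNumerator_div
  set O := stageNumerator fV with hOdef
  set D : ℕ → ℕ → Bool := fun t n =>
    (((decode₂ (List Bool) n).bind (fU t)).map (B t)).getD false with hDdef
  have hDp {t : ℕ} {p : List Bool} :
      D t (encode p) = true ↔ ∃ σ, fU t p = some σ ∧ B t σ = true := by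
    simp only [hDdef, encodek₂, Option.bind_some]
    cases h : fU t p <;> simp
  have hDdec {t n : ℕ} (h : D t n = true) : ∃ p : List Bool, n = encode p := by
    simp only [hDdef] at h
    cases hn : decode₂ (List Bool) n with
    | none => simp [hn] at h
    | some p => exact ⟨p, (mem_decode₂.1 hn).symm⟩
  have hDc : Computable₂ D := by
    refine .option_getD (.option_map (.option_bind (Primrec.decode₂.to_comp.comp .snd) ?_) ?_)
      (.const false)
    · exact (hfU.computable.comp (.comp .fst .fst) .snd).to₂
    · exact (hB.comp (.comp .fst .fst) .snd).to₂
  have hDconv {n s r t : ℕ} (hsr : s ≤ r) (hrt : r ≤ t) (hs : D s n = true) (ht : D t n = true) :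
      D r n = true := by
    obtain ⟨p, rfl⟩ := hDdec hs
    obtain ⟨σ, hσ, hBs⟩ := hDp.1 hs
    obtain ⟨τ, hτ, hBt⟩ := hDp.1 ht
    obtain rfl : σ = τ := Part.mem_unique (hfU.sound hσ) (hfU.sound hτ)
    exact hDp.2 ⟨σ, hfU.mono hsr hσ, hBconv hsr hrt hBs hBt⟩
  set m : ℕ → ℕ := fun n => ((decode₂ (List Bool) n).map List.length).getD 0 with hm
  have hmp (p : List Bool) : m (encode p) = p.length := by simp [hm]
  have hmc : Computable m :=
    .option_getD (.option_map Primrec.decode₂.to_comp (Computable.list_length.comp .snd).to₂)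
      (.const 0)
  have hmn (n : ℕ) : m n ≤ n := by
    cases hn : decode₂ (List Bool) n with
    | none => simp [hm, hn]
    | some p =>
      obtain rfl := mem_decode₂.1 hn
      rw [hmp]
      exact length_le_encode p
  have hfin := hfV.finite_setOf_change hV hDc hDconv hmc hmn (W := 0) fun A hA => by
    have hS := Finset.sum_preimage (encode : List Bool → ℕ) A encode_injective.injOn
      (fun n => (2⁻¹ : ℝ) ^ m n) fun n hn hnr => by
        obtain ⟨t, ht⟩ := hA n hn
        obtain ⟨p, rfl⟩ := hDdec ht
        exact absurd ⟨p, rfl⟩ hnr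
    rw [← hS, pow_zero]
    simp only [hmp]
    refine hU.sum_le_one fun p hp => ?_
    obtain ⟨t, ht⟩ := hA _ (Finset.mem_preimage.1 hp)
    obtain ⟨σ, hσ, -⟩ := hDp.1 ht
    exact (hfU.sound hσ).1
  -- For each program, the test is right from some stage on.
  have hlim (p : List Bool) : ∃ T, ∀ t, T ≤ t →
      (D t (encode p) = true ↔ ∃ i, initialSegment X i ∈ U p) := by
    by_cases hp : (U p).Dom
    · obtain ⟨σ, hσ⟩ := Part.dom_iff_mem.1 hp
      obtain ⟨T₁, hT₁⟩ := hfU.complete hσ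
      obtain ⟨T₂, hT₂⟩ := Filter.eventually_atTop.1 (hBlim σ)
      refine ⟨max T₁ T₂, fun t ht => ?_⟩
      have hft := hfU.mono (le_of_max_le_left ht) hT₁
      rw [hDp, hft]
      simp only [Option.some.injEq, exists_eq_left']
      rw [hT₂ t (le_of_max_le_right ht)]
      constructor
      · exact fun h => ⟨_, h ▸ hσ⟩
      · rintro ⟨i, hi⟩
        rw [Part.mem_unique hσ hi, length_initialSegment]
    · refine ⟨0, fun t _ => ⟨fun h => ?_, fun ⟨i, hi⟩ => absurd hi.1 hp⟩⟩
      obtain ⟨σ, hσ, -⟩ := hDp.1 h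
      exact absurd (hfU.sound hσ).1 hp
  choose T hT using hlim
  obtain ⟨s₀, hs₀⟩ : ∃ s₀, ∀ p : List Bool, encode p ∈ hfin.toFinset → T p ≤ s₀ :=
    ⟨(hfin.toFinset.preimage encode encode_injective.injOn).sup T, fun p hp =>
      Finset.le_sup (f := T) (Finset.mem_preimage.2 hp)⟩
  refine ⟨s₀, fun s hs u hu p hpu => ?_⟩
  rw [← hDp]
  by_cases hexc : encode p ∈ hfin.toFinset
  · exact hT p s ((hs₀ p hexc).trans hs)
  · have hconst (d : ℕ) : D (s + d) (encode p) = D s (encode p) := by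
      induction d with
      | zero => rfl
      | succ d ih =>
        rw [← ih]
        by_contra hne
        rw [hfin.mem_toFinset] at hexc
        refine hexc ⟨s + d, hne, ?_⟩
        -- The halting probability is less than `2⁻ᵘ` away from its approximation.
        rw [hmp]
        have h1 := Nat.lt_floor_add_one (haltingProbability V * 2 ^ u)
        have h2 : ⌊haltingProbability V * 2 ^ u⌋₊ * 2 ^ s ≤ O s * 2 ^ u := by
          rw [← hu]
          exact Nat.div_mul_le_self _ _
        have h3 : (⌊haltingProbability V * 2 ^ u⌋₊ : ℝ) ≤ O s / 2 ^ s * 2 ^ u := by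
          rw [div_mul_eq_mul_div, le_div_iff₀ (by positivity)]
          exact_mod_cast h2
        have h4 : (O s : ℝ) / 2 ^ s ≤ O (s + d + 1) / 2 ^ (s + d + 1) := hO (by omega)
        have h5 : (2⁻¹ : ℝ) ^ u ≤ 2⁻¹ ^ p.length :=
          pow_le_pow_of_le_one (by norm_num) (by norm_num) hpu
        have h6 : haltingProbability V < O s / 2 ^ s + 2⁻¹ ^ u := by
          refine lt_of_mul_lt_mul_right (a := (2 : ℝ) ^ u) ?_ (by positivity)
          rw [add_mul, ← mul_pow]
          norm_num
          linarith
        linarith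
    rw [← hconst (T p)]
    exact hT p _ (Nat.le_add_left _ _)

theorem exists_stageNumerator_div_eq (hV : IsUniversalPrefixFree V) (hfV : IsStaging V fV)
    (s₀ u : ℕ) : ∃ k,
      stageNumerator fV (s₀ + k) * 2 ^ u / 2 ^ (s₀ + k) = ⌊haltingProbability V * 2 ^ u⌋₊ := by
  set v := ⌊haltingProbability V * 2 ^ u⌋₊ with hv
  have hpos : 0 ≤ haltingProbability V := tsum_nonneg fun _ => by positivity
  have hlt : (v : ℝ) / 2 ^ u < haltingProbability V := by
    refine lt_of_le_of_ne ?_ (hV.haltingProbability_ne_div v u).symm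
    rw [div_le_iff₀ (by positivity)]
    exact Nat.floor_le (by positivity)
  obtain ⟨t, ht⟩ := hfV.exists_lt_stageNumerator_div hV.toIsPrefixFreeMachine hlt
  refine ⟨t, Nat.div_eq_of_lt_le ?_ ?_⟩
  · have h1 := ht.le.trans (hfV.monotone_stageNumerator_div (Nat.le_add_left t s₀))
    dsimp only at h1
    rw [div_le_div_iff₀ (by positivity) (by positivity)] at h1
    exact_mod_cast h1
  · have h1 := hfV.stageNumerator_div_le hV.toIsPrefixFreeMachine (s₀ + t)
    have h2 := Nat.lt_floor_add_one (haltingProbability V * 2 ^ u)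
    have h3 : (stageNumerator fV (s₀ + t) : ℝ) * 2 ^ u < (v + 1) * 2 ^ (s₀ + t) := by
      rw [div_le_iff₀ (by positivity)] at h1
      calc (stageNumerator fV (s₀ + t) : ℝ) * 2 ^ u
          ≤ haltingProbability V * 2 ^ (s₀ + t) * 2 ^ u := by gcongr
        _ = haltingProbability V * 2 ^ u * 2 ^ (s₀ + t) := by ring
        _ < (v + 1) * 2 ^ (s₀ + t) := by gcongr
    exact_mod_cast h3

/-- At a stage `s`, it can be decided whether some program of length at most `u` has output an
extension of a string of length `n` that passes the test `B s`; if so, such a string is found. -/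
theorem IsStaging.exists_computable_prefix_search (hfU : IsStaging U fU) (hB : Computable₂ B) :
    ∃ F : (ℕ × ℕ) × ℕ → Option (List Bool), Computable F ∧
      (∀ {s u n τ}, F ((s, u), n) = some τ → ∃ p σ, fU s p = some σ ∧ B s σ = true ∧
        p.length ≤ u ∧ n ≤ σ.length ∧ σ.take n = τ) ∧
      ∀ {s u n}, F ((s, u), n) = none → ∀ {p σ}, fU s p = some σ → B s σ = true →
        p.length ≤ u → σ.length < n := by
  set cand : (ℕ × ℕ) × ℕ → ℕ → Option (List Bool) := fun a k =>
    (decode₂ (List Bool) k).bind fun p => (fU a.1.1 p).bind fun σ =>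
      bif B a.1.1 σ && (decide (p.length ≤ a.1.2) && decide (a.2 ≤ σ.length))
      then some (σ.take a.2) else none with hcand
  have hcandc : Computable₂ cand := by
    have h : Computable₂ fun (q : ((ℕ × ℕ) × ℕ) × ℕ) (p : List Bool) =>
        (fU q.1.1.1 p).bind fun σ =>
          bif B q.1.1.1 σ && (decide (p.length ≤ q.1.1.2) && decide (q.1.2 ≤ σ.length))
          then some (σ.take q.1.2) else none := by
      have ha : Computable fun q : ((((ℕ × ℕ) × ℕ) × ℕ) × List Bool) × List Bool => q.1.1.1 :=
        Computable.fst.comp (Computable.fst.comp .fst)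
      refine Computable.option_bind (hfU.computable.comp
        (Computable.fst.comp (Computable.fst.comp (Computable.fst.comp .fst))) .snd)
        (Computable.to₂ (f := fun q : ((((ℕ × ℕ) × ℕ) × ℕ) × List Bool) × List Bool =>
          bif B q.1.1.1.1.1 q.2 && (decide (q.1.2.length ≤ q.1.1.1.1.2) &&
            decide (q.1.1.1.2 ≤ q.2.length)) then some (q.2.take q.1.1.1.2) else none) ?_)
      refine .cond (.and (hB.comp (Computable.fst.comp (Computable.fst.comp ha)) .snd) (.and
        (.decide_le (Computable.list_length.comp (Computable.snd.comp .fst))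
          (Computable.snd.comp (Computable.fst.comp ha)))
        (.decide_le (Computable.snd.comp ha) (Computable.list_length.comp .snd)))) ?_ (.const none)
      exact Computable.option_some.comp
        (Primrec.list_take.to_comp.comp (Computable.snd.comp ha) .snd)
    exact Computable.option_bind (Primrec.decode₂.to_comp.comp .snd) h
  have hcand_some {s u n k : ℕ} {τ : List Bool} : cand ((s, u), n) k = some τ ↔
      ∃ p σ, encode p = k ∧ fU s p = some σ ∧ B s σ = true ∧ p.length ≤ u ∧ n ≤ σ.length ∧
        σ.take n = τ := by
    have h {p σ : List Bool} : (bif B s σ && (decide (p.length ≤ u) && decide (n ≤ σ.length))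
        then some (σ.take n) else none) = some τ ↔
        B s σ = true ∧ p.length ≤ u ∧ n ≤ σ.length ∧ σ.take n = τ := by
      rw [Bool.cond_eq_ite]
      simp [and_assoc]
    simp only [hcand, Option.bind_eq_some_iff, decode₂_eq_some, h]
    exact ⟨fun ⟨p, hp, σ, hσ, h⟩ => ⟨p, σ, hp, hσ, h⟩, fun ⟨p, σ, hp, hσ, h⟩ => ⟨p, hp, σ, hσ, h⟩⟩
  obtain ⟨F, hF, hF_some, hF_none⟩ :=
    exists_computable_search hcandc (Computable.fst.comp Computable.fst)
  refine ⟨F, hF, fun h => ?_, fun {s u n} h {p σ} hσ hb hpu => ?_⟩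
  · obtain ⟨k, -, hk⟩ := hF_some _ _ h
    obtain ⟨p, σ, -, h⟩ := hcand_some.1 hk
    exact ⟨p, σ, h⟩
  · by_contra hn
    have := hF_none _ h (encode p) (hfU.bound hσ)
    rw [hcand_some.2 ⟨p, σ, rfl, hσ, hb, hpu, not_lt.1 hn, rfl⟩] at this
    cases this

end Decoding

theorem mainTheorem8 (U V : List Bool →. List Bool)
    (hU : IsUniversalPrefixFree U) (hV : IsUniversalPrefixFree V)
    (X : ℕ → Bool) (hX : IsLeftCE (streamValue X)) :
    ComputableWithUse X (binaryExpansion (haltingProbability V))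
      (fun n => ⨅ (i : ℕ) (_ : n ≤ i), complexity U (initialSegment X i)) := by
  classical
  obtain ⟨fU, hfU⟩ := exists_isStaging hU.partrec
  obtain ⟨fV, hfV⟩ := exists_isStaging hV.partrec
  obtain ⟨B, hB, hBconv, hBlim⟩ := exists_computable_prefix_test hX
  obtain ⟨s₀, hs₀⟩ := exists_forall_prefix_test_correct hU.toIsPrefixFreeMachine hV hfU hfV hB
    hBconv hBlim
  set Ω := haltingProbability V with hΩ
  have hΩ1 : Ω < 1 := lt_of_le_of_ne hV.toIsPrefixFreeMachine.haltingProbability_le_one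
    (by simpa using hV.haltingProbability_ne_div 1 0)
  have hval (u : ℕ) : binaryValue (initialSegment (binaryExpansion Ω) u) = ⌊Ω * 2 ^ u⌋₊ :=
    binaryValue_initialSegment_binaryExpansion hΩ1 u
  -- The least length of a program for a prefix of `X` of length at least `n`.
  have hex (n : ℕ) : ∃ u, ∃ i, n ≤ i ∧ ∃ p, initialSegment X i ∈ U p ∧ p.length ≤ u := by
    obtain ⟨p, hp⟩ := hU.exists_mem (initialSegment X n)
    exact ⟨p.length, n, le_rfl, p, hp, le_rfl⟩
  have huse : (fun n => ⨅ (i : ℕ) (_ : n ≤ i), complexity U (initialSegment X i)) =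
      fun n => ((Nat.find (hex n) : ℕ) : ℕ∞) := by
    funext n
    refine le_antisymm ?_ (le_iInf₂ fun i hi => le_iInf₂ fun p hp =>
      Nat.cast_le.2 (Nat.find_min' (hex n) ⟨i, hi, p, hp, le_rfl⟩))
    obtain ⟨i, hi, p, hp, hlen⟩ := Nat.find_spec (hex n)
    exact (iInf₂_le i hi).trans ((iInf₂_le p hp).trans (Nat.cast_le.2 hlen))
  rw [huse]
  obtain ⟨F, hF, hF_some, hF_none⟩ := hfU.exists_computable_prefix_search hB
  have hF_spec {s u n : ℕ} (hs : s₀ ≤ s)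
      (hsu : stageNumerator fV s * 2 ^ u / 2 ^ s = ⌊Ω * 2 ^ u⌋₊) :
      (u < Nat.find (hex n) → F ((s, u), n) = none) ∧
        (u = Nat.find (hex n) → F ((s, u), n) = some (initialSegment X n)) := by
    have hsome {τ : List Bool} (h : F ((s, u), n) = some τ) :
        Nat.find (hex n) ≤ u ∧ τ = initialSegment X n := by
      obtain ⟨p, σ, hσ, hb, hpu, hn, rfl⟩ := hF_some h
      obtain ⟨i, hi⟩ := (hs₀ s hs u hsu p hpu).1 ⟨σ, hσ, hb⟩
      obtain rfl := Part.mem_unique (hfU.sound hσ) hi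
      rw [length_initialSegment] at hn
      exact ⟨Nat.find_min' (hex n) ⟨i, hn, p, hi, hpu⟩, take_initialSegment X hn⟩
    refine ⟨fun hlt => ?_, fun heq => ?_⟩
    · rw [Option.eq_none_iff_forall_ne_some]
      exact fun τ hτ => (hsome hτ).1.not_gt hlt
    · cases h : F ((s, u), n) with
      | some τ => rw [(hsome h).2]
      | none =>
        obtain ⟨i, hi, p, hp, hlen⟩ := Nat.find_spec (hex n)
        obtain ⟨σ, hσ, hb⟩ := (hs₀ s hs u hsu p (heq ▸ hlen)).2 ⟨i, hp⟩
        have hσX : σ = initialSegment X i := Part.mem_unique (hfU.sound hσ) hp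
        have := hF_none h hσ hb (heq ▸ hlen)
        rw [hσX, length_initialSegment] at this
        exact absurd hi this.not_ge
  set right : List Bool → ℕ → Bool := fun w k => decide
    (stageNumerator fV (s₀ + k) * 2 ^ w.length / 2 ^ (s₀ + k) = binaryValue w) with hright
  have hrightc : Computable₂ right := by
    have hs : Computable fun q : List Bool × ℕ => s₀ + q.2 := .nat_add (.const s₀) .snd
    exact .decide_eq (.nat_div (.nat_mul (hfV.computable_stageNumerator.comp hs)
      (.two_pow (Computable.list_length.comp .fst))) (.two_pow hs))
      (primrec_binaryValue.to_comp.comp .fst)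
  have hT : Partrec₂ fun (n : ℕ) (w : List Bool) =>
      (Nat.rfind fun k => (right w k : Part Bool)).map fun k => F ((s₀ + k, w.length), n) := by
    refine Partrec.map (Partrec.rfind (p := fun (q : ℕ × List Bool) k => (right q.2 k : Part Bool))
      ?_) (Computable.to₂ (hF.comp (.pair (.pair (.nat_add (.const s₀) .snd)
        (Computable.list_length.comp (Computable.snd.comp .fst)))
          (Computable.fst.comp .fst))))
    exact (hrightc.comp (Computable.snd.comp .fst) .snd).partrec
  have hstage (u : ℕ) : ∃ k ∈ Nat.rfind fun k =>
      (right (initialSegment (binaryExpansion Ω) u) k : Part Bool),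
      stageNumerator fV (s₀ + k) * 2 ^ u / 2 ^ (s₀ + k) = ⌊Ω * 2 ^ u⌋₊ := by
    obtain ⟨k, hk⟩ := exists_stageNumerator_div_eq hV hfV s₀ u
    obtain ⟨k', hk', -⟩ := Nat.rfind_min'
      (p := right (initialSegment (binaryExpansion Ω) u)) (m := k)
      (by simpa [hright, hval] using hk)
    exact ⟨k', hk', by simpa [hright, hval] using Nat.rfind_spec hk'⟩
  refine computableWithUse_of_partrec hT (fun n u hu => ?_) fun n => ?_
  · obtain ⟨k, hk, hsu⟩ := hstage u
    refine (Part.mem_map_iff _).2 ⟨k, hk, ?_⟩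
    rw [length_initialSegment]
    exact (hF_spec (Nat.le_add_right _ _) hsu).1 hu
  · obtain ⟨k, hk, hsu⟩ := hstage (Nat.find (hex n))
    refine (Part.mem_map_iff _).2 ⟨k, hk, ?_⟩
    rw [length_initialSegment]
    exact (hF_spec (Nat.le_add_right _ _) hsu).2 rfl
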